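/- Let $k$ be an algebraically closed field of characteristic zero. Let $\mathcal{O}(M_3)=k[x_{ij}:1\le i,j\le 3]$ carry the Poisson bracket (the $k$-bilinear skew-symmetric biderivation) determined, for all $i<l$ and $j<m$, by \[\{x_{ij},x_{im}\}=x_{ij}x_{im},\quad \{x_{ij},x_{lj}\}=x_{ij}x_{lj},\quad \{x_{im},x_{lm}\}=x_{im}x_{lm},\quad \{x_{lj},x_{lm}\}=x_{lj}x_{lm},\] \[\{x_{im},x_{lj}\}=0,\quad \{x_{ij},x_{lm}\}=2x_{im}x_{lj},\] and let $\mathcal{O}(SL_3)=\mathcal{O}(M_3)/\langle \mathrm{Det}-1\rangle$ carry the induced Poisson bracket, where $\mathrm{Det}=\det(x_{ij})$. Let the torus \[\mathcal{H}=\{(\alpha_1,\alpha_2,\alpha_3,\beta_1,\beta_2,\beta_3)\in(k^\times)^6:\alpha_1\alpha_2\alpha_3\beta_1\beta_2\beta_3=1\}\] act on $\mathcal{O}(SL_3)$ by $k$-algebra automorphisms with $h.x_{ij}=\alpha_i\beta_jx_{ij}$. An ideal $I$ is called Poisson if $\{I,\mathcal{O}(SL_3)\}\subseteq I$, and $\mathcal{H}$-stable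 if $h(I)=I$ for all $h\in\mathcal{H}$. A Poisson $\mathcal{H}$-prime of $\mathcal{O}(SL_3)$ is a proper $\mathcal{H}$-stable Poisson ideal $I$ such that, whenever $J,K$ are $\mathcal{H}$-stable Poisson ideals with $JK\subseteq I$, then $J\subseteq I$ or $K\subseteq I$. Then for every Poisson $\mathcal{H}$-prime $I$ of $\mathcal{O}(SL_3)$, the commutative ring $\mathcal{O}(SL_3)/I$ is a unique factorization domain. -/

import Mathlib

/-- The coordinate ring `O(M₃)` of `3 × 3` matrices: the polynomial ring in the `x_{ij}`. -/
abbrev CoordM3 (k : Type*) [Field k] : Type _ := MvPolynomial (Fin 3 × Fin 3) k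

/-- The determinant of the generic matrix `(x_{ij})`. -/
noncomputable def Det3 (k : Type*) [Field k] : CoordM3 k :=
  (Matrix.mvPolynomialX (Fin 3) (Fin 3) k).det

/-- The ideal `⟨Det - 1⟩` of `O(M₃)`. -/
noncomputable def detIdeal (k : Type*) [Field k] : Ideal (CoordM3 k) :=
  Ideal.span {Det3 k - 1}

/-- The coordinate ring `O(SL₃) = O(M₃) / ⟨Det - 1⟩`. -/
abbrev CoordSL3 (k : Type*) [Field k] : Type _ := CoordM3 k ⧸ detIdeal k

/-- The Poisson bracket of two generators,
`{x_{ij}, x_{lm}} = (sign (l - i) + sign (m - j)) x_{im} x_{lj}`. For `i < l` and `j < m` this says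
`{x_{ij}, x_{im}} = x_{ij} x_{im}`, `{x_{ij}, x_{lj}} = x_{ij} x_{lj}`, `{x_{im}, x_{lj}} = 0`,
`{x_{ij}, x_{lm}} = 2 x_{im} x_{lj}`, and the bracket is skew-symmetric. -/
noncomputable def genBracket (k : Type*) [Field k] (a b : Fin 3 × Fin 3) : CoordM3 k :=
  ((Int.sign (((b.1 : ℕ) : ℤ) - ((a.1 : ℕ) : ℤ)) +
      Int.sign (((b.2 : ℕ) : ℤ) - ((a.2 : ℕ) : ℤ)) : ℤ) : CoordM3 k) *
    (MvPolynomial.X (a.1, b.2) * MvPolynomial.X (b.1, a.2))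

/-- The Poisson bracket of `O(M₃)`: the unique `k`-bilinear biderivation with the given values on
pairs of generators. -/
noncomputable def bracketM3 (k : Type*) [Field k] (f g : CoordM3 k) : CoordM3 k :=
  ∑ a, ∑ b, genBracket k a b * (MvPolynomial.pderiv a f * MvPolynomial.pderiv b g)

section Helpers

variable {k : Type*} [Field k]

lemma genBracket_skew (a b : Fin 3 × Fin 3) : genBracket k a b = - genBracket k b a := by
  unfold genBracket
  rw [← neg_sub ((a.1 : ℕ) : ℤ), ← neg_sub ((a.2 : ℕ) : ℤ), Int.sign_neg, Int.sign_neg]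
  push_cast
  ring

lemma bracketM3_skew (f g : CoordM3 k) : bracketM3 k f g = - bracketM3 k g f := by
  unfold bracketM3
  rw [Finset.sum_comm, ← Finset.sum_neg_distrib]
  refine Finset.sum_congr rfl fun a _ => ?_
  rw [← Finset.sum_neg_distrib]
  refine Finset.sum_congr rfl fun b _ => ?_
  rw [genBracket_skew]
  ring

lemma bracketM3_add_left (f g h : CoordM3 k) :
    bracketM3 k (f + g) h = bracketM3 k f h + bracketM3 k g h := by
  simp only [bracketM3, map_add, add_mul, mul_add, Finset.sum_add_distrib]

lemma bracketM3_mul_left (f g h : CoordM3 k) :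
    bracketM3 k (f * g) h = f * bracketM3 k g h + g * bracketM3 k f h := by
  simp only [bracketM3, Finset.mul_sum, ← Finset.sum_add_distrib, Derivation.leibniz, smul_eq_mul]
  refine Finset.sum_congr rfl fun a _ => Finset.sum_congr rfl fun b _ => ?_
  ring

lemma bracketM3_sub_left (f g h : CoordM3 k) :
    bracketM3 k (f - g) h = bracketM3 k f h - bracketM3 k g h := by
  simp only [bracketM3, map_sub, sub_mul, mul_sub, Finset.sum_sub_distrib]

/-- `Det` is Poisson central. -/
lemma bracketM3_det (g : CoordM3 k) : bracketM3 k (Det3 k) g = 0 := by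
  unfold bracketM3
  rw [Finset.sum_comm]
  refine Finset.sum_eq_zero fun b _ => ?_
  have key : ∑ a, genBracket k a b * MvPolynomial.pderiv a (Det3 k) = 0 := by
    rw [Fintype.sum_prod_type]
    simp only [Fin.sum_univ_three]
    fin_cases b <;>
    · simp [Det3, Matrix.det_fin_three, genBracket, MvPolynomial.pderiv_X]
      try ring
  simp only [← mul_assoc, ← Finset.sum_mul, key, zero_mul]

lemma bracketM3_mem_left {f : CoordM3 k} (hf : f ∈ detIdeal k) (g : CoordM3 k) :
    bracketM3 k f g ∈ detIdeal k := by
  obtain ⟨c, rfl⟩ := Ideal.mem_span_singleton'.1 hf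
  have h1 : bracketM3 k (1 : CoordM3 k) g = 0 := by simp [bracketM3]
  rw [bracketM3_mul_left, bracketM3_sub_left, bracketM3_det, h1, sub_zero, mul_zero, zero_add]
  exact Ideal.mul_mem_right _ _ (Ideal.subset_span rfl)

lemma bracketM3_congr {f f' g g' : CoordM3 k} (hf : f - f' ∈ detIdeal k)
    (hg : g - g' ∈ detIdeal k) : bracketM3 k f g - bracketM3 k f' g' ∈ detIdeal k := by
  have h : bracketM3 k f g - bracketM3 k f' g' =
      bracketM3 k (f - f') g - bracketM3 k (g - g') f' := by
    rw [bracketM3_sub_left, bracketM3_sub_left, bracketM3_skew g f', bracketM3_skew g' f']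
    ring
  rw [h]
  exact sub_mem (bracketM3_mem_left hf _) (bracketM3_mem_left hg _)

end Helpers

/-- The Poisson bracket induced on the quotient `O(SL₃)`: `{f + I, g + I} = {f, g} + I`. -/
noncomputable def bracketSL3 (k : Type*) [Field k] (u v : CoordSL3 k) : CoordSL3 k :=
  Quotient.map₂ (bracketM3 k)
    (fun _ _ hf _ _ hg => (Submodule.quotientRel_def _).2
      (bracketM3_congr ((Submodule.quotientRel_def _).1 hf) ((Submodule.quotientRel_def _).1 hg)))
    u v

lemma bracketSL3_mk {k : Type*} [Field k] (f g : CoordM3 k) :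
    bracketSL3 k (Ideal.Quotient.mk (detIdeal k) f) (Ideal.Quotient.mk (detIdeal k) g) =
      Ideal.Quotient.mk (detIdeal k) (bracketM3 k f g) := rfl

/-- The torus `H' = {(α₁, α₂, α₃, β₁, β₂, β₃) ∈ (kˣ)⁶ : α₁ α₂ α₃ β₁ β₂ β₃ = 1}`. -/
def torusSL3 (k : Type*) [Field k] : Subgroup ((Fin 3 → kˣ) × (Fin 3 → kˣ)) where
  carrier := {h | (∏ i, h.1 i) * (∏ j, h.2 j) = 1}
  one_mem' := by simp
  mul_mem' := by
    intro a b ha hb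
    simp only [Set.mem_ofPred_eq, Prod.fst_mul, Prod.snd_mul, Pi.mul_apply,
      Finset.prod_mul_distrib] at ha hb ⊢
    rw [mul_mul_mul_comm, ha, hb, one_mul]
  inv_mem' := by
    intro a ha
    simp only [Set.mem_ofPred_eq, Prod.fst_inv, Prod.snd_inv, Pi.inv_apply,
      Finset.prod_inv_distrib] at ha ⊢
    rw [← mul_inv, ha, inv_one]

/-- `h · x_{ij} = α_i β_j x_{ij}` on `O(M₃)`, for `h = (α, β)`. -/
noncomputable def actM3 (k : Type*) [Field k] (h : (Fin 3 → kˣ) × (Fin 3 → kˣ)) :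
    CoordM3 k →ₐ[k] CoordM3 k :=
  MvPolynomial.aeval fun p => MvPolynomial.C ((h.1 p.1 : k) * (h.2 p.2 : k)) * MvPolynomial.X p

lemma actM3_det {k : Type*} [Field k] (h : torusSL3 k) : actM3 k h.1 (Det3 k) = Det3 k := by
  have h1 : (∏ i, h.1.1 i) * (∏ j, h.1.2 j) = 1 := h.2
  have h2 : (∏ i, (h.1.1 i : k)) * (∏ j, (h.1.2 j : k)) = 1 := by
    have := congrArg (Units.val) h1
    simpa using this
  have h3 := congrArg (MvPolynomial.C (σ := Fin 3 × Fin 3)) h2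
  simp only [Fin.prod_univ_three, map_mul, map_one] at h3
  simp only [actM3, Det3, Matrix.det_fin_three, Matrix.mvPolynomialX_apply, map_add, map_sub,
    map_mul, MvPolynomial.aeval_X]
  generalize MvPolynomial.X (R := k) ((0 : Fin 3), (0 : Fin 3)) = x00
  linear_combination (x00 * MvPolynomial.X (1, 1) * MvPolynomial.X (2, 2)
    - x00 * MvPolynomial.X (1, 2) * MvPolynomial.X (2, 1)
    - MvPolynomial.X (0, 1) * MvPolynomial.X (1, 0) * MvPolynomial.X (2, 2)
    + MvPolynomial.X (0, 1) * MvPolynomial.X (1, 2) * MvPolynomial.X (2, 0)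
    + MvPolynomial.X (0, 2) * MvPolynomial.X (1, 0) * MvPolynomial.X (2, 1)
    - MvPolynomial.X (0, 2) * MvPolynomial.X (1, 1) * MvPolynomial.X (2, 0)) * h3

lemma detIdeal_le_comap {k : Type*} [Field k] (h : torusSL3 k) :
    detIdeal k ≤ (detIdeal k).comap (actM3 k h.1) := by
  refine Ideal.span_le.2 ?_
  rintro _ rfl
  rw [SetLike.mem_coe, Ideal.mem_comap, map_sub, map_one, actM3_det]
  exact Ideal.subset_span rfl

/-- The induced action of `H'` on `O(SL₃)`: `h · x_{ij} = α_i β_j x_{ij}`. -/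
noncomputable def actSL3 (k : Type*) [Field k] (h : torusSL3 k) : CoordSL3 k →ₐ[k] CoordSL3 k :=
  Ideal.quotientMapₐ (detIdeal k) (actM3 k h.1) (detIdeal_le_comap h)

/-- `I` is a Poisson ideal of `O(SL₃)`: `{I, O(SL₃)} ⊆ I`. -/
def IsPoissonIdeal {k : Type*} [Field k] (I : Ideal (CoordSL3 k)) : Prop :=
  ∀ u ∈ I, ∀ v : CoordSL3 k, bracketSL3 k u v ∈ I

/-- `I` is stable under the torus: `h(I) = I` for all `h`. -/
def IsTorusStable {k : Type*} [Field k] (I : Ideal (CoordSL3 k)) : Prop :=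
  ∀ h : torusSL3 k, actSL3 k h '' (I : Set (CoordSL3 k)) = I

/-- Poisson `H`-primes of `O(SL₃)`: proper torus-stable Poisson ideals `I` such that, for all
torus-stable Poisson ideals `J` and `K` with `J K ⊆ I`, one has `J ⊆ I` or `K ⊆ I`. -/
structure IsPoissonHPrime {k : Type*} [Field k] (I : Ideal (CoordSL3 k)) : Prop where
  ne_top : I ≠ ⊤
  poisson : IsPoissonIdeal I
  stable : IsTorusStable I
  mem_or_mem : ∀ J K : Ideal (CoordSL3 k), IsPoissonIdeal J → IsTorusStable J →
    IsPoissonIdeal K → IsTorusStable K → J * K ≤ I → J ≤ I ∨ K ≤ I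

/-! A Poisson `H`-prime `I` is an honest prime (`IsPoissonHPrime.isPrime`). In characteristic zero
the minimal primes over a Poisson ideal are Poisson, and the torus, being a divisible group, acts
trivially on the finite set of minimal primes. A product of these primes lies in `I`, so one of them
is contained in `I` and hence equals it.

Let `Q` be the preimage of `I` in `O(M₃)`. Brackets with matrix entries show that `Q` never contains
`x₁₁` or the leading 2 × 2 minor, and that `x₁₃ ∉ Q` forces `x₁₂ ∉ Q`. Six vanishing patterns remain
above the diagonal and, by transposition, six below. So `Q` contains one of 36 explicit ideals
`cellIdeal k u v` and avoids certain entries and minors `clusterVar`. Modulo `cellIdeal k u v`,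
every element becomes a polynomial in these after multiplication by a product of them
(`mem_saturation_clusterVar`). They are torus eigenvectors with log-canonical brackets, and the
resulting eigenvalues separate their monomials, so no nonzero polynomial in them lies in `Q`
(`IsPoissonTorusPrime.eq_zero_of_aeval_clusterVar_mem`). As `cellIdeal k u v` is prime, `Q` equals
it (`IsPoissonTorusPrime.exists_eq_cellIdeal`).

It remains to see that the 36 quotients are factorial domains (`ufd_cellIdeal`). The tool is
Nagata's criterion. When only variables vanish, `Det = 1` becomes an equation linear in one
variable, whose leading coefficient is up to sign a product of variables that are prime or
invertible in the quotient. Transposition and inversion of matrices reduce the patterns with a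
vanishing minor to these, except for one locus isomorphic to `SL₂ × SL₂`. For `SL₃` itself one
inverts `x₁₃` and the upper right minor, which are prime because their zero loci are cells already
treated. -/

open MvPolynomial

/-! ### Nagata's criterion -/

theorem dvd_of_dvd_mul_of_mem_closure {A : Type*} [CommRing A] [IsDomain A] {S : Set A}
    (hS : ∀ s ∈ S, Prime s ∨ IsUnit s) {x : A} (hx : ∀ s ∈ S, Prime s → ¬ s ∣ x)
    {m : A} (hm : m ∈ Submonoid.closure S) : ∀ f, x ∣ m * f → x ∣ f := by
  induction hm using Submonoid.closure_induction with
  | mem s hs =>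
    intro f hf
    rcases hS s hs with hp | hu
    · obtain ⟨c, hc⟩ := hf
      have : s ∣ x * c := hc ▸ dvd_mul_right _ _
      obtain ⟨d, rfl⟩ := (hp.dvd_or_dvd this).resolve_left (hx s hs hp)
      exact ⟨d, mul_left_cancel₀ hp.ne_zero (by rw [hc]; ring)⟩
    · exact (hu.dvd_mul_left).1 hf
  | one => simp
  | mul a b _ _ iha ihb =>
    intro f hf
    rw [mul_assoc] at hf
    exact ihb _ (iha _ hf)

/-- Dividing out primes of `S` one at a time stops, since proper divisibility is well founded in a
Noetherian domain. -/
theorem exists_eq_mul_of_mem_closure {A : Type*} [CommRing A] [IsDomain A] [IsNoetherianRing A]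
    (S : Set A) (x : A) (hx : x ≠ 0) :
    ∃ m ∈ Submonoid.closure S, ∃ y, x = m * y ∧ ∀ s ∈ S, Prime s → ¬ s ∣ y := by
  induction x using (WellFounded.induction (wellFounded_dvdNotUnit (α := A))) with
  | _ x ih =>
    by_cases h : ∃ s ∈ S, Prime s ∧ s ∣ x
    · obtain ⟨s, hs, hp, y, rfl⟩ := h
      have hy : y ≠ 0 := right_ne_zero_of_mul hx
      obtain ⟨m, hm, z, rfl, hz⟩ := ih y ⟨hy, s, hp.not_isUnit, mul_comm _ _⟩ hy
      exact ⟨s * m, mul_mem (Submonoid.subset_closure hs) hm, z, (mul_assoc _ _ _).symm, hz⟩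
    · push Not at h
      exact ⟨1, one_mem _, x, (one_mul x).symm, h⟩

/-- A form of Nagata's criterion: a Noetherian domain is factorial as soon as, up to products of
elements of `S` that are prime or invertible, it is a factorial subring. -/
theorem UniqueFactorizationMonoid.of_nagata {R A : Type*} [CommRing R] [IsDomain R]
    [UniqueFactorizationMonoid R] [CommRing A] [IsDomain A] [IsNoetherianRing A]
    (φ : R →+* A) (hφ : Function.Injective φ) (S : Set A) (hS : ∀ s ∈ S, Prime s ∨ IsUnit s)
    (hSφ : ∀ s ∈ S, s ∈ φ.range)
    (hgen : ∀ f : A, ∃ m ∈ Submonoid.closure S, ∃ g, m * f = φ g) :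
    UniqueFactorizationMonoid A := by
  -- Kaplansky's criterion: find a prime element in every nonzero prime ideal `P`. Only a `P`
  -- disjoint from `S` needs work, and it contracts to a nonzero prime of `R`.
  refine UniqueFactorizationMonoid.iff_exists_prime_mem_of_isPrime.2 fun P hP0 hP => ?_
  have hrange : ∀ m ∈ Submonoid.closure S, ∃ n, φ n = m := fun m hm =>
    have h : Submonoid.closure S ≤ φ.range.toSubmonoid := Submonoid.closure_le.2 hSφ
    h hm
  by_cases hSP : ∃ s ∈ S, s ∈ P
  · obtain ⟨s, hs, hsP⟩ := hSP
    exact ⟨s, hsP, (hS s hs).resolve_right fun hu => hP.ne_top (P.eq_top_of_isUnit_mem hsP hu)⟩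
  push Not at hSP
  have hcl : ∀ m ∈ Submonoid.closure S, m ∉ P := fun m hm =>
    have h : Submonoid.closure S ≤ P.primeCompl := Submonoid.closure_le.2 hSP
    h hm
  have hQ0 : P.comap φ ≠ ⊥ := by
    obtain ⟨f, hf, hf0⟩ := Submodule.exists_mem_ne_zero_of_ne_bot hP0
    obtain ⟨m, hm, g, hg⟩ := hgen f
    intro h
    have : g ∈ P.comap φ := by
      rw [Ideal.mem_comap, ← hg]
      exact P.mul_mem_left _ hf
    rw [h, Ideal.mem_bot] at this
    rw [this, map_zero] at hg
    rcases mul_eq_zero.1 hg with h0 | h0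
    · exact hcl m hm (h0 ▸ P.zero_mem)
    · exact hf0 h0
  obtain ⟨π, hπP, hπ⟩ := (UniqueFactorizationMonoid.iff_exists_prime_mem_of_isPrime (R := R)).1
    inferInstance (P.comap φ) hQ0 inferInstance
  rw [Ideal.mem_comap] at hπP
  -- The prime element is `y`, which is `φ π` stripped of its prime factors in `S`: up to products
  -- of elements of `S`, divisibility by `y` is divisibility by `π` in `R`.
  obtain ⟨m, hm, y, hy, hSy⟩ := exists_eq_mul_of_mem_closure S (φ π)
    ((map_ne_zero_iff φ hφ).2 hπ.ne_zero)
  have hyP : y ∈ P := (hP.mem_or_mem (hy ▸ hπP)).resolve_left (hcl m hm)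
  refine ⟨y, hyP, right_ne_zero_of_mul (hy ▸ (map_ne_zero_iff φ hφ).2 hπ.ne_zero),
    fun hu => hP.ne_top (P.eq_top_of_isUnit_mem hyP hu), ?_⟩
  have key : ∀ f f₁ n, φ n ∈ Submonoid.closure S → φ n * f = φ f₁ → π ∣ f₁ → y ∣ f := by
    rintro f f₁ n hn hf ⟨c, rfl⟩
    refine dvd_of_dvd_mul_of_mem_closure hS hSy hn f ?_
    rw [hf, map_mul, hy]
    exact ⟨m * φ c, by ring⟩
  rintro f g ⟨h, hfg⟩
  obtain ⟨m₁, hm₁, f₁, hf₁⟩ := hgen f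
  obtain ⟨m₂, hm₂, g₁, hg₁⟩ := hgen g
  obtain ⟨m₃, hm₃, h₁, hh₁⟩ := hgen h
  obtain ⟨n, rfl⟩ := hrange m hm
  obtain ⟨n₁, rfl⟩ := hrange m₁ hm₁
  obtain ⟨n₂, rfl⟩ := hrange m₂ hm₂
  obtain ⟨n₃, rfl⟩ := hrange m₃ hm₃
  have hR : n * n₃ * (f₁ * g₁) = π * (h₁ * n₁ * n₂) := by
    apply hφ
    simp only [map_mul]
    rw [← hf₁, ← hg₁, ← hh₁, hy]
    linear_combination (φ n * φ n₃ * φ n₁ * φ n₂) * hfg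
  have hdvd : π ∣ n * n₃ * (f₁ * g₁) := ⟨_, hR⟩
  rcases hπ.dvd_or_dvd hdvd with hd | hd
  · obtain ⟨c, hc⟩ := hd
    refine absurd ?_ (hcl _ (mul_mem hm hm₃))
    rw [← map_mul, hc, map_mul]
    exact P.mul_mem_right _ hπP
  · rcases hπ.dvd_or_dvd hd with hd | hd
    · exact .inl (key f f₁ n₁ hm₁ hf₁ hd)
    · exact .inr (key g g₁ n₂ hm₂ hg₁ hd)

/-! ### Ideals generated by some variables and one polynomial -/

theorem Ideal.sup_span_eq_comap_of_retraction {R : Type*} [CommRing R] (e : R →+* R) (K : Ideal R)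
    (hK : ∀ x ∈ K, e x = 0) (he : ∀ x, x - e x ∈ K) (b : R) :
    K ⊔ Ideal.span {b} = (Ideal.span {e b}).comap e := by
  have heb : e b ∈ K ⊔ Ideal.span {b} := by
    have h := sub_mem ((le_sup_right : Ideal.span {b} ≤ K ⊔ Ideal.span {b})
      (Ideal.mem_span_singleton_self b)) ((le_sup_left : K ≤ K ⊔ Ideal.span {b}) (he b))
    simpa using h
  apply le_antisymm
  · refine sup_le (fun x hx => ?_) ?_
    · rw [Ideal.mem_comap, hK x hx]
      exact zero_mem _
    · rw [Ideal.span_le, Set.singleton_subset_iff]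
      exact Ideal.mem_span_singleton_self _
  · intro x hx
    rw [Ideal.mem_comap, Ideal.mem_span_singleton'] at hx
    obtain ⟨c, hc⟩ := hx
    have h1 : e x ∈ K ⊔ Ideal.span {b} := hc ▸ Ideal.mul_mem_left _ _ heb
    simpa using add_mem h1 ((le_sup_left : K ≤ K ⊔ Ideal.span {b}) (he x))

section KillVars

variable {σ : Type*} [DecidableEq σ] {R : Type*} [CommRing R]

/-- The substitution setting the variables in `Z` to zero. -/
noncomputable def killVars (R : Type*) [CommRing R] (Z : Finset σ) :
    MvPolynomial σ R →ₐ[R] MvPolynomial σ R :=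
  aeval fun i => if i ∈ Z then 0 else X i

/-- The ideal generated by the variables in `Z` and by `q`. -/
noncomputable def varsIdeal (Z : Finset σ) (q : MvPolynomial σ R) : Ideal (MvPolynomial σ R) :=
  Ideal.span (X '' (Z : Set σ)) ⊔ Ideal.span {q}

theorem killVars_X (Z : Finset σ) (i : σ) :
    killVars R Z (X i) = if i ∈ Z then 0 else X i := by
  simp [killVars]

theorem killVars_eq_zero (Z : Finset σ) (x : MvPolynomial σ R)
    (hx : x ∈ Ideal.span (X '' (Z : Set σ))) : killVars R Z x = 0 := by
  have : Ideal.span (X '' (Z : Set σ)) ≤ RingHom.ker (killVars R Z) := by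
    rw [Ideal.span_le]
    rintro _ ⟨i, hi, rfl⟩
    simp [killVars_X, Finset.mem_coe.1 hi]
  exact this hx

theorem sub_killVars_mem (Z : Finset σ) (x : MvPolynomial σ R) :
    x - killVars R Z x ∈ Ideal.span (X '' (Z : Set σ)) := by
  rw [← Ideal.Quotient.mk_eq_mk_iff_sub_mem]
  have : (Ideal.Quotient.mkₐ R (Ideal.span (X '' (Z : Set σ)))) =
      (Ideal.Quotient.mkₐ R _).comp (killVars R Z) := by
    ext i
    by_cases hi : i ∈ Z
    · simp only [AlgHom.comp_apply, killVars_X, if_pos hi, map_zero]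
      exact Ideal.Quotient.eq_zero_iff_mem.2 (Ideal.subset_span ⟨i, hi, rfl⟩)
    · simp [killVars_X, hi]
  exact DFunLike.congr_fun this x

/-- Substituting zero is a retraction with kernel spanned by the variables in `Z`. Membership,
primality and triviality of the ideal are thereby read off from the single polynomial `killVars R Z
q`. -/
theorem varsIdeal_eq_comap (Z : Finset σ) (q : MvPolynomial σ R) :
    varsIdeal Z q = (Ideal.span {killVars R Z q}).comap (killVars R Z) :=
  Ideal.sup_span_eq_comap_of_retraction (killVars R Z : MvPolynomial σ R →+* MvPolynomial σ R) _
    (killVars_eq_zero Z) (sub_killVars_mem Z) q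

theorem varsIdeal_isPrime (Z : Finset σ) (q : MvPolynomial σ R) (h : Prime (killVars R Z q)) :
    (varsIdeal Z q).IsPrime := by
  rw [varsIdeal_eq_comap]
  have := (Ideal.span_singleton_prime h.ne_zero).2 h
  infer_instance

theorem varsIdeal_eq_top (Z : Finset σ) (q : MvPolynomial σ R) (h : IsUnit (killVars R Z q)) :
    varsIdeal Z q = ⊤ := by
  rw [varsIdeal_eq_comap, Ideal.span_singleton_eq_top.2 h, Ideal.comap_top]

theorem varsIdeal_insert (Z : Finset σ) (q : MvPolynomial σ R) (i : σ) :
    varsIdeal Z q ⊔ Ideal.span {X i} = varsIdeal (insert i Z) q := by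
  rw [varsIdeal, varsIdeal, Finset.coe_insert, Set.image_insert_eq, Ideal.span_insert]
  ac_rfl

theorem killVars_of_mem_supported {Z : Finset σ} {s : Set σ} (hs : ∀ i ∈ s, i ∉ Z)
    {x : MvPolynomial σ R} (hx : x ∈ supported R s) : killVars R Z x = x := by
  induction hx using Algebra.adjoin_induction with
  | mem x hx =>
    obtain ⟨i, hi, rfl⟩ := hx
    simp [killVars_X, hs i hi]
  | algebraMap r => simp
  | add x y _ _ hx hy => simp [hx, hy]
  | mul x y _ _ hx hy => simp [hx, hy]

theorem constantCoeff_killVars (Z : Finset σ) (x : MvPolynomial σ R) :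
    constantCoeff (killVars R Z x) = constantCoeff x := by
  induction x using MvPolynomial.induction_on with
  | C r => simp [killVars]
  | add p q hp hq => simp [hp, hq]
  | mul_X p i hp =>
    rw [map_mul, map_mul, map_mul, hp, killVars_X]
    split_ifs <;> simp

theorem killVars_insert (Z : Finset σ) (v : σ) (x : MvPolynomial σ R) :
    killVars R (insert v Z) x = killVars R {v} (killVars R Z x) := by
  have : killVars R (insert v Z) = (killVars R {v}).comp (killVars R Z) := by
    ext1 i
    by_cases hi : i ∈ Z
    · simp [killVars_X, hi]
    · simp [killVars_X, hi]
  rw [this, AlgHom.comp_apply]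

end KillVars

/-! ### Equations linear in one variable -/

section Supported

variable {σ : Type*} {R : Type*} [CommRing R]

theorem notMem_vars_of_mem_supported {s : Set σ} {i : σ} (hi : i ∉ s) {x : MvPolynomial σ R}
    (hx : x ∈ supported R s) : i ∉ x.vars := fun h => hi (mem_supported.1 hx h)

theorem prime_mul_X_add [IsDomain R] [UniqueFactorizationMonoid R] {s : Set σ} {j : σ}
    (hj : j ∉ s) {a b : MvPolynomial σ R} (ha : a ∈ supported R s) (hb : b ∈ supported R s)
    (ha0 : a ≠ 0) (hab : IsRelPrime a b) : Prime (a * X j + b) :=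
  (irreducible_mul_X_add a b j ha0 (notMem_vars_of_mem_supported hj ha)
    (notMem_vars_of_mem_supported hj hb) hab).prime

/-- The divisor has positive degree in `X j`, whereas `x` has degree zero. -/
theorem eq_zero_of_dvd_of_mem_supported [IsDomain R] {s : Set σ} {j : σ} (hj : j ∉ s)
    {a b x : MvPolynomial σ R} (hb : b ∈ supported R s) (ha0 : a ≠ 0)
    (hx : x ∈ supported R s) (h : a * X j + b ∣ x) : x = 0 := by
  classical
  by_contra hx0
  obtain ⟨c, rfl⟩ := h
  have h0 := not_not.1 (mt mem_vars_iff_degreeOf_ne_zero.2 (notMem_vars_of_mem_supported hj hx))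
  rw [degreeOf_mul_eq (left_ne_zero_of_mul hx0) (right_ne_zero_of_mul hx0)] at h0
  have h1 : degreeOf j (a * X j + b) = 0 := by omega
  have h2 : j ∉ (a * X j + b).vars := fun h => mem_vars_iff_degreeOf_ne_zero.1 h h1
  have hb' := notMem_vars_of_mem_supported hj hb
  have h3 : j ∉ (a * X j).vars := fun h => by
    have := vars_sub_subset (p := a * X j + b) (q := b)
    rw [add_sub_cancel_right] at this
    simpa [h2, hb'] using this h
  have h4 := not_not.1 (mt mem_vars_iff_degreeOf_ne_zero.2 h3)
  rw [degreeOf_mul_eq ha0 (X_ne_zero j)] at h4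
  simp at h4

end Supported

section Hypersurface

variable {σ : Type*} [DecidableEq σ] {R : Type*} [CommRing R] [IsDomain R]
  [UniqueFactorizationMonoid R]

/-- Factoriality of the quotient by some variables and an equation that becomes linear in the
variable `j`, with leading coefficient a product of elements of `S`. -/
theorem uniqueFactorizationMonoid_varsIdeal [Finite σ] [IsNoetherianRing R] (Z : Finset σ)
    (q : MvPolynomial σ R) (s : Set σ) (hsZ : ∀ i, i ∉ s → i ∈ Z ∨ i = j) (hZs : ∀ i ∈ s, i ∉ Z)
    (hjs : j ∉ s) (hjZ : j ∉ Z) (a b : MvPolynomial σ R)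
    (hq : killVars R Z q = a * X j + b) (ha : a ∈ supported R s) (hb : b ∈ supported R s)
    (hprime : Prime (a * X j + b)) (S : Set (MvPolynomial σ R)) (haS : a ∈ Submonoid.closure S)
    (hSs : ∀ x ∈ S, x ∈ supported R s ∧ x ≠ 0)
    (hS : ∀ x ∈ S, (varsIdeal Z q ⊔ Ideal.span {x}).IsPrime ∨
      varsIdeal Z q ⊔ Ideal.span {x} = ⊤) :
    IsDomain (MvPolynomial σ R ⧸ varsIdeal Z q) ∧
      UniqueFactorizationMonoid (MvPolynomial σ R ⧸ varsIdeal Z q) := by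
  have hP : (varsIdeal Z q).IsPrime := varsIdeal_isPrime Z q (hq ▸ hprime)
  have hdom : IsDomain (MvPolynomial σ R ⧸ varsIdeal Z q) := Ideal.Quotient.isDomain _
  refine ⟨hdom, ?_⟩
  have ha0 : a ≠ 0 := by
    have : Submonoid.closure S ≤ nonZeroDivisors (MvPolynomial σ R) :=
      Submonoid.closure_le.2 fun x hx => mem_nonZeroDivisors_of_ne_zero (hSs x hx).2
    exact nonZeroDivisors.ne_zero (this haS)
  have : UniqueFactorizationMonoid (supported R s) :=
    (supportedEquivMvPolynomial s).toMulEquiv.symm.uniqueFactorizationMonoid inferInstance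
  let mk := Ideal.Quotient.mkₐ R (varsIdeal Z q)
  let φ : supported R s →ₐ[R] MvPolynomial σ R ⧸ varsIdeal Z q := mk.comp (supported R s).val
  have hinj : ∀ x ∈ supported R s, mk x = 0 → x = 0 := by
    intro x hx h
    have h := Ideal.Quotient.eq_zero_iff_mem.1 h
    rw [varsIdeal_eq_comap, Ideal.mem_comap, killVars_of_mem_supported hZs hx, hq,
      Ideal.mem_span_singleton] at h
    exact eq_zero_of_dvd_of_mem_supported hjs hb ha0 hx h
  have hmkS : Submonoid.map mk (Submonoid.closure S) = Submonoid.closure (mk '' S) :=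
    MonoidHom.map_mclosure _ _
  refine UniqueFactorizationMonoid.of_nagata φ.toRingHom ?_ (mk '' S) ?_ ?_ ?_
  · rw [injective_iff_map_eq_zero]
    exact fun x hx => Subtype.ext (hinj x x.2 hx)
  · rintro _ ⟨x, hx, rfl⟩
    have hmk0 : mk x ≠ 0 := fun h => (hSs x hx).2 (hinj x (hSs x hx).1 h)
    -- This translates primality or invertibility of the class of `x` into the hypothesis `hS` on
    -- ideals of the polynomial ring.
    have hcomap : (Ideal.span {mk x}).comap mk = varsIdeal Z q ⊔ Ideal.span {x} := by
      have h1 : Ideal.span {mk x} = (Ideal.span {x}).map (Ideal.Quotient.mk (varsIdeal Z q)) := by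
        rw [Ideal.map_span, Set.image_singleton]
        rfl
      rw [h1, sup_comm]
      exact (Ideal.comap_map_of_surjective _ Ideal.Quotient.mk_surjective _).trans
        (by rw [← RingHom.ker_eq_comap_bot, Ideal.mk_ker])
    rcases hS x hx with h | h
    · left
      rw [← Ideal.span_singleton_prime hmk0]
      rw [← hcomap] at h
      rw [← Ideal.map_comap_of_surjective mk Ideal.Quotient.mk_surjective (Ideal.span {mk x})]
      refine Ideal.map_isPrime_of_surjective Ideal.Quotient.mk_surjective ?_
      refine (Ideal.mk_ker (I := varsIdeal Z q)).le.trans ?_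
      exact hcomap ▸ le_sup_left
    · right
      rw [← Ideal.span_singleton_eq_top, Ideal.eq_top_iff_one]
      have : (1 : MvPolynomial σ R) ∈ (Ideal.span {mk x}).comap mk := by
        rw [hcomap, h]; trivial
      simpa using this
  · rintro _ ⟨x, hx, rfl⟩
    exact ⟨⟨x, (hSs x hx).1⟩, rfl⟩
  · intro f
    obtain ⟨f, rfl⟩ := Ideal.Quotient.mk_surjective f
    induction f using MvPolynomial.induction_on with
    | C r => exact ⟨1, one_mem _, ⟨C r, Subalgebra.algebraMap_mem _ r⟩, one_mul _⟩
    | add f g hf hg =>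
      obtain ⟨m, hm, x, hx⟩ := hf
      obtain ⟨n, hn, y, hy⟩ := hg
      rw [← hmkS] at hm hn ⊢
      have hSle : Submonoid.closure S ≤ (supported R s).toSubmonoid :=
        Submonoid.closure_le.2 fun x hx => (hSs x hx).1
      obtain ⟨m, hm, rfl⟩ := hm
      obtain ⟨n, hn, rfl⟩ := hn
      refine ⟨mk (m * n), ⟨m * n, mul_mem hm hn, rfl⟩,
        ⟨n, hSle hn⟩ * x + ⟨m, hSle hm⟩ * y, ?_⟩
      rw [map_add φ.toRingHom, map_mul φ.toRingHom, map_mul φ.toRingHom, ← hx, ← hy, map_mul mk,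
        map_add]
      change mk m * mk n * (_ + _) = mk n * (mk m * _) + mk m * (mk n * _)
      ring
    | mul_X f i hf =>
      obtain ⟨m, hm, x, hx⟩ := hf
      by_cases his : i ∈ s
      · refine ⟨m, hm, x * ⟨X i, X_mem_supported.2 his⟩, ?_⟩
        rw [map_mul, map_mul, ← mul_assoc, hx]
        rfl
      rcases hsZ i his with hi | rfl
      · refine ⟨1, one_mem _, 0, ?_⟩
        have : Ideal.Quotient.mk (varsIdeal Z q) (X i) = 0 := Ideal.Quotient.eq_zero_iff_mem.2
          ((le_sup_left : _ ≤ varsIdeal Z q) (Ideal.subset_span ⟨i, hi, rfl⟩))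
        rw [map_mul, this]
        simp
      -- In the quotient `a * X j = -b`, so one more factor `a` eliminates one occurrence of `X j`.
      · refine ⟨mk a * m, mul_mem (hmkS ▸ ⟨a, haS, rfl⟩) hm, x * ⟨-b, neg_mem hb⟩, ?_⟩
        have h0 : mk (a * X i + b) = 0 := by
          refine Ideal.Quotient.eq_zero_iff_mem.2 ?_
          rw [varsIdeal_eq_comap, Ideal.mem_comap, hq, map_add, map_mul,
            killVars_of_mem_supported hZs ha, killVars_of_mem_supported hZs hb, killVars_X,
            if_neg hjZ]
          exact Ideal.mem_span_singleton_self _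
        rw [map_add, map_mul] at h0
        rw [map_mul, map_mul, ← hx]
        change mk a * m * (mk f * mk (X i)) = (m * mk f) * mk (-b)
        rw [map_neg]
        linear_combination m * mk f * h0

end Hypersurface

section LinearEquation

variable {σ : Type*} [DecidableEq σ] {R : Type*} [CommRing R] [IsDomain R]
  [UniqueFactorizationMonoid R]

/-- A linear polynomial with relatively prime coefficients is prime, and `b` is prime to a product
of variables once none of them divides it. The test for the latter is that `b` survives setting the
variable to zero. -/
theorem prime_prod_X_mul_X_add (V : Finset σ) (j : σ) (u : Rˣ) (b : MvPolynomial σ R)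
    (hVj : j ∉ V) (hb : b ∈ supported R ({j}ᶜ : Set σ))
    (hV : ∀ v ∈ V, killVars R {v} b ≠ 0) : Prime (C (u : R) * (∏ v ∈ V, X v) * X j + b) := by
  refine prime_mul_X_add (s := {j}ᶜ) (by simp) ?_ hb (mul_ne_zero (by simp) (Finset.prod_ne_zero_iff.2 fun v _ => X_ne_zero v)) ?_
  · refine mul_mem (Subalgebra.algebraMap_mem _ (u : R)) (prod_mem fun v hv => ?_)
    exact X_mem_supported.2 fun h => hVj (h ▸ hv)
  · refine IsRelPrime.mul_left (u.isUnit.map C).isRelPrime_left ?_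
    refine IsRelPrime.prod_left fun v hv => ?_
    rw [(X_prime (i := v)).irreducible.isRelPrime_iff_not_dvd]
    rintro ⟨c, rfl⟩
    exact hV v hv (by simp [killVars_X])

/-- Factoriality of the quotient by the variables in `Z` and by an equation that becomes linear in
the variable `j`, with leading coefficient a product of distinct variables. -/
theorem uniqueFactorizationMonoid_varsIdeal_of_linear [Finite σ] [IsNoetherianRing R]
    (Z V : Finset σ) (j : σ) (u : Rˣ) (q b : MvPolynomial σ R) (hVZ : ∀ v ∈ V, v ∉ Z ∧ v ≠ j)
    (hjZ : j ∉ Z) (hb : b ∈ supported R ((insert j Z : Finset σ) : Set σ)ᶜ)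
    (hq : killVars R Z q = C (u : R) * (∏ v ∈ V, X v) * X j + b)
    (hV : ∀ v ∈ V, Prime (killVars R (insert v Z) q) ∨ IsUnit (killVars R (insert v Z) q)) :
    IsDomain (MvPolynomial σ R ⧸ varsIdeal Z q) ∧
      UniqueFactorizationMonoid (MvPolynomial σ R ⧸ varsIdeal Z q) := by
  have hjV : j ∉ V := fun h => (hVZ j h).2 rfl
  -- If `v ∈ V` divided `b`, killing `v` would turn `q` into zero, which is neither prime nor a
  -- unit.
  have hprime : Prime (C (u : R) * (∏ v ∈ V, X v) * X j + b) := by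
    refine prime_prod_X_mul_X_add V j u b hjV
      (supported_mono (by simp) hb) fun v hv h0 => ?_
    have h1 : killVars R (insert v Z) q = 0 := by
      rw [killVars_insert, hq, map_add, h0, map_mul, map_mul, map_prod,
        Finset.prod_eq_zero hv (by simp [killVars_X])]
      simp
    rcases hV v hv with h | h
    · exact h.ne_zero h1
    · exact not_isUnit_zero (h1 ▸ h)
  have hXs : ∀ v ∈ V, (X v : MvPolynomial σ R) ∈
      supported R ((insert j Z : Finset σ) : Set σ)ᶜ := fun v hv =>
    X_mem_supported.2 (by simpa [not_or] using (hVZ v hv).symm)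
  refine uniqueFactorizationMonoid_varsIdeal (j := j) Z q ((insert j Z : Finset σ) : Set σ)ᶜ
    (by simp; tauto) (by simp) (by simp) hjZ _ b hq
    (mul_mem (Subalgebra.algebraMap_mem _ (u : R)) (prod_mem hXs)) hb hprime
    -- The constant `u` joins the variables in `S` so that the whole leading coefficient is a
    -- product of elements of `S`.
    (insert (C (u : R)) (X '' (V : Set σ))) ?_ ?_ ?_
  · exact mul_mem (Submonoid.subset_closure (Set.mem_insert _ _))
      (prod_mem fun v hv => Submonoid.subset_closure (Set.mem_insert_of_mem _ ⟨v, hv, rfl⟩))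
  · rintro x (rfl | ⟨v, hv, rfl⟩)
    · exact ⟨Subalgebra.algebraMap_mem _ (u : R), by simp⟩
    · exact ⟨hXs v hv, X_ne_zero v⟩
  · rintro x (rfl | ⟨v, hv, rfl⟩)
    · right
      rw [Ideal.span_singleton_eq_top.2 (u.isUnit.map C), sup_top_eq]
    · rw [varsIdeal_insert]
      exact (hV v hv).imp (varsIdeal_isPrime _ _) (varsIdeal_eq_top _ _)

end LinearEquation

/-- The coordinate ring of `SL₂` over `R`. -/
noncomputable abbrev CoordSL2 (R : Type*) [CommRing R] : Type _ :=
  MvPolynomial (Fin 4) R ⧸ varsIdeal ∅ (X 0 * X 3 - X 1 * X 2 - 1 : MvPolynomial (Fin 4) R)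

/-- The equation is linear in `X 3` with leading coefficient `X 0`. Setting `X 0` to zero leaves `-X
1 * X 2 - 1`, which is linear in `X 2` and prime. -/
theorem uniqueFactorizationMonoid_coordSL2 (R : Type*) [CommRing R] [IsDomain R]
    [UniqueFactorizationMonoid R] [IsNoetherianRing R] :
    IsDomain (CoordSL2 R) ∧ UniqueFactorizationMonoid (CoordSL2 R) := by
  refine uniqueFactorizationMonoid_varsIdeal_of_linear ∅ {0} 3 1 _ (-(X 1 * X 2) - 1)
    (by simp) (by simp) ?_ (by simp [killVars_X]; ring) ?_
  · apply_rules [sub_mem, neg_mem, mul_mem, one_mem, X_mem_supported.2] <;> simp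
  · intro v hv
    obtain rfl := Finset.mem_singleton.1 hv
    left
    convert prime_prod_X_mul_X_add (R := R) {(1 : Fin 4)} 2 (-1) (-1) (by simp) ?_ ?_ using 1
    · simp [killVars_X]; ring
    · exact neg_mem (one_mem _)
    · simp

/-! ### Determinant equations of diagonal and block shape -/

section SL3

variable {k : Type*} [Field k]

theorem killVars_det (Z : Finset (Fin 3 × Fin 3)) : killVars k Z (Det3 k - 1) =
    killVars k Z (X (0, 0)) * killVars k Z (X (1, 1)) * killVars k Z (X (2, 2))
    - killVars k Z (X (0, 0)) * killVars k Z (X (1, 2)) * killVars k Z (X (2, 1))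
    - killVars k Z (X (0, 1)) * killVars k Z (X (1, 0)) * killVars k Z (X (2, 2))
    + killVars k Z (X (0, 1)) * killVars k Z (X (1, 2)) * killVars k Z (X (2, 0))
    + killVars k Z (X (0, 2)) * killVars k Z (X (1, 0)) * killVars k Z (X (2, 1))
    - killVars k Z (X (0, 2)) * killVars k Z (X (1, 1)) * killVars k Z (X (2, 0)) - 1 := by
  simp only [Det3, Matrix.det_fin_three, Matrix.mvPolynomialX_apply, map_add, map_sub, map_mul,
    map_one]

/-- The equation is linear in `x₃₃`; its leading coefficient `x₁₁ x₂₂` is a unit in the quotient, as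
killing either factor leaves `-1`. -/
theorem ufd_of_det_diagonal (Z : Finset (Fin 3 × Fin 3)) (h0 : (0, 0) ∉ Z) (h1 : (1, 1) ∉ Z)
    (h2 : (2, 2) ∉ Z)
    (hq : killVars k Z (Det3 k - 1) = X (0, 0) * X (1, 1) * X (2, 2) - 1) :
    IsDomain (CoordM3 k ⧸ varsIdeal Z (Det3 k - 1)) ∧
      UniqueFactorizationMonoid (CoordM3 k ⧸ varsIdeal Z (Det3 k - 1)) := by
  refine uniqueFactorizationMonoid_varsIdeal_of_linear Z {(0, 0), (1, 1)} (2, 2) 1 _ (-1)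
    (by simp [h0, h1]) h2 (neg_mem (one_mem _)) (by rw [hq]; simp; ring) fun v hv => ?_
  right
  have : killVars k (insert v Z) (Det3 k - 1) = -1 := by
    rw [killVars_insert, hq]
    simp only [Finset.mem_insert, Finset.mem_singleton] at hv
    rcases hv with rfl | rfl <;> simp [killVars_X]
  rw [this]
  exact isUnit_one.neg

theorem prime_mul_minor_sub_one {σ : Type*} [DecidableEq σ] {t a b c d : σ}
    (h : [t, a, b, c, d].Nodup) :
    Prime (X t * (X a * X b - X c * X d) - 1 : MvPolynomial σ k) := by
  simp only [List.nodup_cons, List.mem_cons, List.not_mem_nil, or_false, not_or] at h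
  convert prime_prod_X_mul_X_add (R := k) {t, a} b 1 (-(X t * X c * X d) - 1) (by grind) ?_ ?_
    using 1
  · rw [Finset.prod_pair (by grind)]
    simp; ring
  · apply_rules [sub_mem, neg_mem, mul_mem, one_mem, X_mem_supported.2] <;> simp <;> grind
  -- The constant term `-1` survives every substitution of zero for variables.
  · intro v hv h0
    have := congrArg constantCoeff h0
    rw [constantCoeff_killVars] at this
    simp at this

/-- The equation is linear in `b` with leading coefficient `t * a`. Here `t` is invertible in the
quotient, and killing `a` leaves `-t * c * d - 1`, which is prime because it is linear in `d`. -/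
theorem ufd_of_det_block (Z : Finset (Fin 3 × Fin 3)) (t a b c d : Fin 3 × Fin 3)
    (h : [t, a, b, c, d].Nodup) (hZ : ∀ i ∈ [t, a, b, c, d], i ∉ Z)
    (hq : killVars k Z (Det3 k - 1) = X t * (X a * X b - X c * X d) - 1) :
    IsDomain (CoordM3 k ⧸ varsIdeal Z (Det3 k - 1)) ∧
      UniqueFactorizationMonoid (CoordM3 k ⧸ varsIdeal Z (Det3 k - 1)) := by
  simp only [List.nodup_cons, List.mem_cons, List.not_mem_nil, or_false, not_or] at h hZ
  refine uniqueFactorizationMonoid_varsIdeal_of_linear Z {t, a} b 1 _ (-(X t * X c * X d) - 1)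
    (by grind) (by grind) ?_ ?_ fun v hv => ?_
  · apply_rules [sub_mem, neg_mem, mul_mem, one_mem, X_mem_supported.2] <;> simp <;> grind
  · rw [hq, Finset.prod_pair (by grind)]
    simp; ring
  · rw [killVars_insert, hq]
    simp only [Finset.mem_insert, Finset.mem_singleton] at hv
    rcases hv with rfl | rfl
    · right
      simp [killVars_X]
    · left
      convert prime_prod_X_mul_X_add (R := k) {t, c} d (-1) (-1) (by grind)
        (neg_mem (one_mem _)) (by simp) using 1
      rw [Finset.prod_pair (by grind)]
      have : t ≠ v ∧ b ≠ v ∧ c ≠ v ∧ d ≠ v := by grind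
      simp [killVars_X, this]
      ring

end SL3

/-! ### Transport along involutions -/

section Transfer

variable {R : Type*} [CommRing R]

/-- An endomorphism exchanging two ideals and involutive modulo each of them identifies the
quotients. -/
noncomputable def quotientEquivOfInvolutive (s : R →+* R) {I J : Ideal R} (hI : ∀ x ∈ I, s x ∈ J)
    (hJ : ∀ x ∈ J, s x ∈ I) (hsI : ∀ x, s (s x) - x ∈ I) (hsJ : ∀ x, s (s x) - x ∈ J) :
    R ⧸ I ≃+* R ⧸ J :=
  RingEquiv.ofRingHom (Ideal.quotientMap J s hI) (Ideal.quotientMap I s hJ)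
    (Ideal.Quotient.ringHom_ext (RingHom.ext fun x => Ideal.Quotient.eq.2 (hsJ x)))
    (Ideal.Quotient.ringHom_ext (RingHom.ext fun x => Ideal.Quotient.eq.2 (hsI x)))

theorem isDomain_ufd_of_ringEquiv {A B : Type*} [CommRing A] [CommRing B] (e : A ≃+* B)
    (h : IsDomain B ∧ UniqueFactorizationMonoid B) :
    IsDomain A ∧ UniqueFactorizationMonoid A :=
  have := h.1
  ⟨e.toMulEquiv.isDomain B, e.symm.toMulEquiv.uniqueFactorizationMonoid h.2⟩

theorem isDomain_ufd_of_involutive (s : R →+* R) {I J : Ideal R} (hI : ∀ x ∈ I, s x ∈ J)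
    (hJ : ∀ x ∈ J, s x ∈ I) (hsI : ∀ x, s (s x) - x ∈ I) (hsJ : ∀ x, s (s x) - x ∈ J)
    (h : IsDomain (R ⧸ J) ∧ UniqueFactorizationMonoid (R ⧸ J)) :
    IsDomain (R ⧸ I) ∧ UniqueFactorizationMonoid (R ⧸ I) :=
  isDomain_ufd_of_ringEquiv (quotientEquivOfInvolutive s hI hJ hsI hsJ) h

end Transfer

/-! ### Transposition, inversion, and the special loci -/

section SL3

variable (k : Type*) [Field k]

/-- The transposition of matrices, on `O(M₃)`. -/
noncomputable def transposeM3 : CoordM3 k →ₐ[k] CoordM3 k := aeval fun p => X p.swap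

/-- The map `X ↦ adj X` on `O(M₃)`, which on `SL₃` is the inversion. -/
noncomputable def adjugateM3 : CoordM3 k →ₐ[k] CoordM3 k :=
  aeval fun p => (Matrix.mvPolynomialX (Fin 3) (Fin 3) k).adjugate p.1 p.2

/-- The minor on rows 1, 2 and columns 2, 3. -/
noncomputable def upperMinor : CoordM3 k :=
  X (0, 1) * X (1, 2) - X (0, 2) * X (1, 1)

/-- The minor on rows 2, 3 and columns 1, 2. -/
noncomputable def lowerMinor : CoordM3 k :=
  X (1, 0) * X (2, 1) - X (1, 1) * X (2, 0)

variable {k}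

theorem det3_eq : Det3 k = X (0, 0) * X (1, 1) * X (2, 2) - X (0, 0) * X (1, 2) * X (2, 1)
    - X (0, 1) * X (1, 0) * X (2, 2) + X (0, 1) * X (1, 2) * X (2, 0)
    + X (0, 2) * X (1, 0) * X (2, 1) - X (0, 2) * X (1, 1) * X (2, 0) := by
  simp only [Det3, Matrix.det_fin_three, Matrix.mvPolynomialX_apply]

theorem transposeM3_transposeM3 (x : CoordM3 k) : transposeM3 k (transposeM3 k x) = x := by
  have : (transposeM3 k).comp (transposeM3 k) = AlgHom.id k _ := by
    ext1 i
    simp [transposeM3]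
  exact DFunLike.congr_fun this x

theorem transposeM3_det : transposeM3 k (Det3 k) = Det3 k := by
  simp only [det3_eq, transposeM3, map_sub, map_add, map_mul, aeval_X, Prod.swap_prod_mk]
  ring

theorem adjugateM3_X (i j : Fin 3) : adjugateM3 k (X (i, j)) =
    (Matrix.mvPolynomialX (Fin 3) (Fin 3) k).adjugate i j := by
  simp [adjugateM3]

theorem adjugateM3_mvPolynomialX : (Matrix.mvPolynomialX (Fin 3) (Fin 3) k).map (adjugateM3 k) =
    (Matrix.mvPolynomialX (Fin 3) (Fin 3) k).adjugate := by
  ext1 i j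
  simp [adjugateM3_X]

theorem adjugateM3_det : adjugateM3 k (Det3 k) = Det3 k ^ 2 := by
  have h := (adjugateM3 k).map_det (Matrix.mvPolynomialX (Fin 3) (Fin 3) k)
  rw [AlgHom.mapMatrix_apply, adjugateM3_mvPolynomialX, Matrix.det_adjugate] at h
  exact h

/-- For 3 × 3 matrices `adj (adj X) = det X • X`, and the determinant is one modulo `I`. -/
theorem adjugateM3_adjugateM3 {I : Ideal (CoordM3 k)} (hI : Det3 k - 1 ∈ I) (x : CoordM3 k) :
    adjugateM3 k (adjugateM3 k x) - x ∈ I := by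
  rw [← Ideal.Quotient.mk_eq_mk_iff_sub_mem]
  have hdet : Ideal.Quotient.mkₐ k I (Det3 k) = 1 :=
    (Ideal.Quotient.mk_eq_mk_iff_sub_mem _ _).2 hI
  have : (Ideal.Quotient.mkₐ k I).comp ((adjugateM3 k).comp (adjugateM3 k)) =
      Ideal.Quotient.mkₐ k I := by
    ext1 ⟨i, j⟩
    have h := (adjugateM3 k).map_adjugate (Matrix.mvPolynomialX (Fin 3) (Fin 3) k)
    rw [AlgHom.mapMatrix_apply, AlgHom.mapMatrix_apply, adjugateM3_mvPolynomialX,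
      Matrix.adjugate_adjugate _ (by simp)] at h
    have h := congrFun (congrFun h i) j
    rw [Matrix.map_apply] at h
    rw [AlgHom.comp_apply, AlgHom.comp_apply, adjugateM3_X, h]
    simp only [Fintype.card_fin, Matrix.smul_apply, Matrix.mvPolynomialX_apply, smul_eq_mul,
      map_mul, map_pow]
    change Ideal.Quotient.mkₐ k I (Det3 k) ^ _ * _ = _
    rw [hdet]
    simp
  exact DFunLike.congr_fun this x

theorem adjugateM3_det_sub_one_mem {I : Ideal (CoordM3 k)} (hI : Det3 k - 1 ∈ I) :
    adjugateM3 k (Det3 k - 1) ∈ I := by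
  rw [map_sub, adjugateM3_det, map_one]
  have : Det3 k ^ 2 - 1 = (Det3 k + 1) * (Det3 k - 1) := by ring
  exact this ▸ I.mul_mem_left _ hI

theorem adjugateM3_explicit :
    adjugateM3 k (X (0, 1)) = -(X (0, 1) * X (2, 2)) + X (0, 2) * X (2, 1) ∧
    adjugateM3 k (X (0, 2)) = X (0, 1) * X (1, 2) - X (0, 2) * X (1, 1) ∧
    adjugateM3 k (X (1, 2)) = -(X (0, 0) * X (1, 2)) + X (0, 2) * X (1, 0) ∧
    adjugateM3 k (X (1, 0)) = -(X (1, 0) * X (2, 2)) + X (1, 2) * X (2, 0) ∧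
    adjugateM3 k (X (2, 0)) = X (1, 0) * X (2, 1) - X (1, 1) * X (2, 0) ∧
    adjugateM3 k (X (2, 1)) = -(X (0, 0) * X (2, 1)) + X (0, 1) * X (2, 0) ∧
    adjugateM3 k (X (1, 1)) = X (0, 0) * X (2, 2) - X (0, 2) * X (2, 0) := by
  simp [adjugateM3_X, Matrix.adjugate_fin_three, Matrix.mvPolynomialX_apply]

/-- Jacobi's identity for complementary minors. Since `x₁₃` conversely maps to the upper minor,
inversion exchanges their zero loci in `SL₃`. -/
theorem adjugateM3_upperMinor : adjugateM3 k (upperMinor k) = Det3 k * X (0, 2) := by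
  obtain ⟨h1, h2, h3, h4, h5, h6, h7⟩ := adjugateM3_explicit (k := k)
  rw [upperMinor, map_sub, map_mul, map_mul, h1, h2, h3, h7, det3_eq]
  ring

/-- With `x₁₃ = 0` the equation is linear in `x₃₁` with leading coefficient `x₁₂ x₂₃`. Killing
either factor makes the matrix block triangular. -/
theorem ufd_kill_02 :
    IsDomain (CoordM3 k ⧸ varsIdeal {(0, 2)} (Det3 k - 1)) ∧
      UniqueFactorizationMonoid (CoordM3 k ⧸ varsIdeal {(0, 2)} (Det3 k - 1)) := by
  refine uniqueFactorizationMonoid_varsIdeal_of_linear {(0, 2)} {(0, 1), (1, 2)} (2, 0) 1 _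
    (X (0, 0) * X (1, 1) * X (2, 2) - X (0, 0) * X (1, 2) * X (2, 1)
      - X (0, 1) * X (1, 0) * X (2, 2) - 1) (by simp) (by simp) ?_ ?_ fun v hv => ?_
  · apply_rules [sub_mem, neg_mem, mul_mem, one_mem, X_mem_supported.2] <;> simp
  · rw [Finset.prod_pair (by simp)]
    simp [killVars_det, killVars_X]
    ring
  · left
    simp only [Finset.mem_insert, Finset.mem_singleton] at hv
    rcases hv with rfl | rfl
    · convert prime_mul_minor_sub_one (k := k) (t := ((0 : Fin 3), (0 : Fin 3))) (a := (1, 1))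
        (b := (2, 2)) (c := (1, 2)) (d := (2, 1)) (by simp) using 1
      simp [killVars_det, killVars_X]
      ring
    · convert prime_mul_minor_sub_one (k := k) (t := ((2 : Fin 3), (2 : Fin 3))) (a := (0, 0))
        (b := (1, 1)) (c := (0, 1)) (d := (1, 0)) (by simp) using 1
      simp [killVars_det, killVars_X]
      ring

/-- With both corners zero, `x₃₁` no longer occurs and the equation is linear in `x₃₂`, with leading
coefficient `-x₁₁ x₂₃`. -/
theorem ufd_kill_02_20 :
    IsDomain (CoordM3 k ⧸ varsIdeal {(0, 2), (2, 0)} (Det3 k - 1)) ∧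
      UniqueFactorizationMonoid (CoordM3 k ⧸ varsIdeal {(0, 2), (2, 0)} (Det3 k - 1)) := by
  refine uniqueFactorizationMonoid_varsIdeal_of_linear {(0, 2), (2, 0)} {(0, 0), (1, 2)} (2, 1)
    (-1) _ (X (0, 0) * X (1, 1) * X (2, 2) - X (0, 1) * X (1, 0) * X (2, 2) - 1)
    (by simp) (by simp) ?_ ?_ fun v hv => ?_
  · apply_rules [sub_mem, neg_mem, mul_mem, one_mem, X_mem_supported.2] <;> simp
  · rw [Finset.prod_pair (by simp)]
    simp [killVars_det, killVars_X]
    ring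
  · left
    simp only [Finset.mem_insert, Finset.mem_singleton] at hv
    rcases hv with rfl | rfl
    · have h := prime_prod_X_mul_X_add (R := k) ({(0, 1), (1, 0)} : Finset (Fin 3 × Fin 3))
        (2, 2) (-1) (-1) (by decide) (neg_mem (one_mem _)) (by simp)
      rw [Finset.prod_pair (by decide)] at h
      convert h using 1
      simp [killVars_det, killVars_X]
      ring
    · convert prime_mul_minor_sub_one (k := k) (t := ((2 : Fin 3), (2 : Fin 3))) (a := (0, 0))
        (b := (1, 1)) (c := (0, 1)) (d := (1, 0)) (by simp) using 1
      simp [killVars_det, killVars_X]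
      ring

/-- The ideal of `O(M₃)` defining the locus `x₁₃ = [23|12] = 0` in `SL₃`. -/
noncomputable def cornerMinorIdeal (k : Type*) [Field k] : Ideal (CoordM3 k) :=
  Ideal.span {X (0, 2), lowerMinor k, Det3 k - 1}

theorem mem_cornerMinorIdeal :
    X (0, 2) ∈ cornerMinorIdeal k ∧ lowerMinor k ∈ cornerMinorIdeal k ∧
      Det3 k - 1 ∈ cornerMinorIdeal k :=
  ⟨Ideal.subset_span (by simp), Ideal.subset_span (by simp), Ideal.subset_span (by simp)⟩

theorem coordSL2_relation (R : Type*) [CommRing R] :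
    (Ideal.Quotient.mk _ (X 0) * Ideal.Quotient.mk _ (X 3) -
      Ideal.Quotient.mk _ (X 1) * Ideal.Quotient.mk _ (X 2) : CoordSL2 R) = 1 := by
  rw [← map_mul, ← map_mul, ← map_sub, ← map_one (Ideal.Quotient.mk _), Ideal.Quotient.eq]
  exact (le_sup_right : Ideal.span _ ≤ varsIdeal ∅ _) (Ideal.mem_span_singleton_self _)

/-- The ring homomorphism out of `O(SL₂)` given by the entries of a matrix of determinant one. -/
noncomputable def coordSL2Lift {R B : Type*} [CommRing R] [CommRing B] (f : R →+* B) (p : Fin 4 → B)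
    (hp : p 0 * p 3 - p 1 * p 2 = 1) : CoordSL2 R →+* B :=
  Ideal.Quotient.lift _ (eval₂Hom f p) (by
    have : varsIdeal ∅ (X 0 * X 3 - X 1 * X 2 - 1) ≤ RingHom.ker (eval₂Hom f p) := by
      rw [varsIdeal, Finset.coe_empty, Set.image_empty, Ideal.span_empty, bot_sup_eq,
        Ideal.span_le, Set.singleton_subset_iff]
      simp [RingHom.mem_ker, hp]
    exact fun x hx => this hx)

theorem coordSL2Lift_X {R B : Type*} [CommRing R] [CommRing B] (f : R →+* B) (p : Fin 4 → B)
    (hp : p 0 * p 3 - p 1 * p 2 = 1) (i : Fin 4) :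
    coordSL2Lift f p hp (Ideal.Quotient.mk _ (X i)) = p i :=
  (Ideal.Quotient.lift_mk _ _ _).trans (eval₂Hom_X' f p i)

theorem coordSL2Lift_C {R B : Type*} [CommRing R] [CommRing B] (f : R →+* B) (p : Fin 4 → B)
    (hp : p 0 * p 3 - p 1 * p 2 = 1) (r : R) :
    coordSL2Lift f p hp (Ideal.Quotient.mk _ (C r)) = f r :=
  (Ideal.Quotient.lift_mk _ _ _).trans (eval₂Hom_C f p r)

/-- The parametrization of the locus `x₁₃ = [23|12] = 0` in `SL₃` by two matrices of determinant
one. -/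
noncomputable def toCoordSL2 (k : Type*) [Field k] : CoordM3 k →ₐ[k] CoordSL2 (CoordSL2 k) :=
  let P : Fin 4 → CoordSL2 (CoordSL2 k) := fun i => Ideal.Quotient.mk _ (X i)
  let p : Fin 4 → CoordSL2 (CoordSL2 k) := fun i =>
    Ideal.Quotient.mk _ (C (Ideal.Quotient.mk _ (X i)))
  let M : Matrix (Fin 3) (Fin 3) (CoordSL2 (CoordSL2 k)) :=
    -- This is the product of the block matrices `diag(1, P)` and `diag(p, 1)`.
    !![p 0, p 1, 0; P 0 * p 2, P 0 * p 3, P 1; P 2 * p 2, P 2 * p 3, P 3]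
  aeval fun i => M i.1 i.2

theorem cornerMinorIdeal_le_ker (k : Type*) [Field k] :
    cornerMinorIdeal k ≤ RingHom.ker (toCoordSL2 k) := by
  have hP := coordSL2_relation (CoordSL2 k)
  have hp := congrArg (fun x => (Ideal.Quotient.mk _ (C x) : CoordSL2 (CoordSL2 k)))
    (coordSL2_relation k)
  simp only [map_sub, map_mul, map_one] at hp
  rw [cornerMinorIdeal, Ideal.span_le]
  rintro x (rfl | rfl | rfl)
  · simp [RingHom.mem_ker, toCoordSL2]
  · simp [RingHom.mem_ker, toCoordSL2, lowerMinor]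
    ring
  · simp [RingHom.mem_ker, toCoordSL2, det3_eq]
    linear_combination hP + (Ideal.Quotient.mk _ (X 0) * Ideal.Quotient.mk _ (X 3) -
      Ideal.Quotient.mk _ (X 1) * Ideal.Quotient.mk _ (X 2)) * hp

theorem cornerMinorIdeal_relations {x : Fin 3 → Fin 3 → CoordM3 k ⧸ cornerMinorIdeal k}
    (hx : ∀ i j, x i j = Ideal.Quotient.mk _ (X (i, j))) :
    x 0 2 = 0 ∧ x 1 0 * x 2 1 - x 1 1 * x 2 0 = 0 ∧
      x 0 0 * x 1 1 * x 2 2 - x 0 0 * x 1 2 * x 2 1 - x 0 1 * x 1 0 * x 2 2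
        + x 0 1 * x 1 2 * x 2 0 = 1 := by
  have h0 : x 0 2 = 0 := (hx 0 2).trans <|
    Ideal.Quotient.eq_zero_iff_mem.2 mem_cornerMinorIdeal.1
  have h1 := Ideal.Quotient.eq_zero_iff_mem.2 (mem_cornerMinorIdeal (k := k)).2.1
  have h2 := Ideal.Quotient.eq_zero_iff_mem.2 (mem_cornerMinorIdeal (k := k)).2.2
  simp only [det3_eq, lowerMinor, map_sub, map_add, map_mul, map_one, ← hx] at h1 h2
  exact ⟨h0, h1, by linear_combination h2 - (x 1 0 * x 2 1 - x 1 1 * x 2 0) * h0⟩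

/-- The inverse of the parametrization `toCoordSL2`. -/
noncomputable def ofCoordSL2 (k : Type*) [Field k] :
    CoordSL2 (CoordSL2 k) →+* CoordM3 k ⧸ cornerMinorIdeal k :=
  let x : Fin 3 → Fin 3 → CoordM3 k ⧸ cornerMinorIdeal k :=
    fun i j => Ideal.Quotient.mk _ (X (i, j))
  have hx := cornerMinorIdeal_relations (x := x) fun _ _ => rfl
  coordSL2Lift
    -- The factors are recovered from the product: `det P = 1` gives the second row of `p` as minors
    -- on rows 2, 3, and `det p = 1` gives the first column of `P` as minors on columns 1, 2.
    (coordSL2Lift (algebraMap k _) ![x 0 0, x 0 1, x 1 0 * x 2 2 - x 1 2 * x 2 0,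
      x 1 1 * x 2 2 - x 1 2 * x 2 1] (by
        simp only [Matrix.cons_val]
        linear_combination hx.2.2))
    ![x 0 0 * x 1 1 - x 0 1 * x 1 0, x 1 2, x 0 0 * x 2 1 - x 0 1 * x 2 0, x 2 2] (by
        simp only [Matrix.cons_val]
        linear_combination hx.2.2)

/-- The locus is `SL₂ × SL₂`, so factoriality of `O(SL₂)` over a Noetherian factorial base is
applied twice. -/
theorem ufd_cornerMinorIdeal :
    IsDomain (CoordM3 k ⧸ cornerMinorIdeal k) ∧
      UniqueFactorizationMonoid (CoordM3 k ⧸ cornerMinorIdeal k) := by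
  have hT : IsDomain (CoordSL2 (CoordSL2 k)) ∧
      UniqueFactorizationMonoid (CoordSL2 (CoordSL2 k)) := by
    obtain ⟨_, _⟩ := uniqueFactorizationMonoid_coordSL2 k
    exact uniqueFactorizationMonoid_coordSL2 (CoordSL2 k)
  let f : CoordM3 k ⧸ cornerMinorIdeal k →+* CoordSL2 (CoordSL2 k) :=
    Ideal.Quotient.lift _ (toCoordSL2 k).toRingHom fun x hx => cornerMinorIdeal_le_ker k hx
  have hP := coordSL2_relation (CoordSL2 k)
  have hp := congrArg (fun x => (Ideal.Quotient.mk _ (C x) : CoordSL2 (CoordSL2 k)))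
    (coordSL2_relation k)
  simp only [map_sub, map_mul, map_one] at hp
  refine isDomain_ufd_of_ringEquiv (RingEquiv.ofRingHom f (ofCoordSL2 k) ?_ ?_) hT
  · refine Ideal.Quotient.ringHom_ext (MvPolynomial.ringHom_ext' (Ideal.Quotient.ringHom_ext
      (MvPolynomial.ringHom_ext' ?_ ?_)) ?_)
    · ext r
      simp only [RingHom.comp_apply, ofCoordSL2, coordSL2Lift_C, RingHom.id_apply]
      exact ((toCoordSL2 k).commutes r)
    · intro i
      simp only [RingHom.comp_apply, ofCoordSL2, coordSL2Lift_C, coordSL2Lift_X, RingHom.id_apply]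
      fin_cases i <;> simp [f, toCoordSL2]
      · linear_combination Ideal.Quotient.mk _ (C (Ideal.Quotient.mk _ (X 2))) * hP
      · linear_combination Ideal.Quotient.mk _ (C (Ideal.Quotient.mk _ (X 3))) * hP
    · intro i
      simp only [RingHom.comp_apply, ofCoordSL2, coordSL2Lift_X, RingHom.id_apply]
      fin_cases i <;> simp [f, toCoordSL2]
      · linear_combination Ideal.Quotient.mk _ (X 0) * hp
      · linear_combination Ideal.Quotient.mk _ (X 2) * hp
  · refine Ideal.Quotient.ringHom_ext (MvPolynomial.ringHom_ext' ?_ ?_)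
    · ext r
      change ofCoordSL2 k (toCoordSL2 k (C r)) = _
      rw [show toCoordSL2 k (C r) = Ideal.Quotient.mk _ (C (Ideal.Quotient.mk _ (C r))) from
        (toCoordSL2 k).commutes r]
      simp only [ofCoordSL2, coordSL2Lift_C]
      rfl
    · rintro ⟨i, j⟩
      change ofCoordSL2 k (toCoordSL2 k (X (i, j))) = Ideal.Quotient.mk _ (X (i, j))
      obtain ⟨h0, h1, h2⟩ := cornerMinorIdeal_relations
        (x := fun i j => Ideal.Quotient.mk (cornerMinorIdeal k) (X (i, j))) fun _ _ => rfl
      simp only [toCoordSL2, aeval_X]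
      fin_cases i <;> fin_cases j <;> simp [ofCoordSL2, coordSL2Lift_C, coordSL2Lift_X]
      · exact h0.symm
      · linear_combination Ideal.Quotient.mk _ (X (1, 0)) * h2 +
          Ideal.Quotient.mk _ (X (0, 0)) * Ideal.Quotient.mk _ (X (1, 2)) * h1
      · linear_combination Ideal.Quotient.mk _ (X (1, 1)) * h2 +
          Ideal.Quotient.mk _ (X (0, 1)) * Ideal.Quotient.mk _ (X (1, 2)) * h1
      · linear_combination Ideal.Quotient.mk _ (X (2, 0)) * h2 +
          Ideal.Quotient.mk _ (X (0, 0)) * Ideal.Quotient.mk _ (X (2, 2)) * h1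
      · linear_combination Ideal.Quotient.mk _ (X (2, 1)) * h2 +
          Ideal.Quotient.mk _ (X (0, 1)) * Ideal.Quotient.mk _ (X (2, 2)) * h1

end SL3

/-! ### Factoriality of the 36 cell closures -/

/-- The six types of vanishing conditions above the diagonal (or below it) that cut out the
closures of the double Bruhat cells of `SL₃`. -/
inductive CellType
  | generic | corner | minor | row | column | triangular

namespace CellType

/-- The equations above the diagonal. -/
noncomputable def upperGens (k : Type*) [Field k] : CellType → Set (CoordM3 k)
  | generic => ∅
  | corner => {X (0, 2)}
  | minor => {upperMinor k}
  | row => {X (0, 1), X (0, 2)}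
  | column => {X (0, 2), X (1, 2)}
  | triangular => {X (0, 1), X (0, 2), X (1, 2)}

/-- The variables vanishing above the diagonal. -/
def upperVars : CellType → Finset (Fin 3 × Fin 3)
  | generic => ∅
  | corner => {(0, 2)}
  | minor => ∅
  | row => {(0, 1), (0, 2)}
  | column => {(0, 2), (1, 2)}
  | triangular => {(0, 1), (0, 2), (1, 2)}

/-- The variables vanishing below the diagonal. -/
def lowerVars : CellType → Finset (Fin 3 × Fin 3)
  | generic => ∅
  | corner => {(2, 0)}
  | minor => ∅
  | row => {(1, 0), (2, 0)}
  | column => {(2, 0), (2, 1)}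
  | triangular => {(1, 0), (2, 0), (2, 1)}

/-- The exchange of types induced by the inversion. -/
def inv : CellType → CellType
  | generic => generic
  | corner => minor
  | minor => corner
  | row => row
  | column => column
  | triangular => triangular

theorem inv_inv (u : CellType) : u.inv.inv = u := by cases u <;> rfl

theorem upperGens_eq (k : Type*) [Field k] {u : CellType} (hu : u ≠ minor) :
    u.upperGens k = X '' (u.upperVars : Set (Fin 3 × Fin 3)) := by
  cases u <;> simp [upperGens, upperVars, Set.image_insert_eq] at hu ⊢

theorem transposeM3_image_upperGens (k : Type*) [Field k] {u : CellType} (hu : u ≠ minor) :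
    transposeM3 k '' u.upperGens k = X '' (u.lowerVars : Set (Fin 3 × Fin 3)) := by
  cases u <;> simp [upperGens, lowerVars, Set.image_insert_eq, transposeM3] at hu ⊢

end CellType

open CellType

/-- The ideal of `O(M₃)` of the closure of a double Bruhat cell of `SL₃`. -/
noncomputable def cellIdeal (k : Type*) [Field k] (u v : CellType) : Ideal (CoordM3 k) :=
  Ideal.span (insert (Det3 k - 1) (u.upperGens k ∪ transposeM3 k '' v.upperGens k))

section Cells

variable {k : Type*} [Field k]

theorem det_sub_one_mem_cellIdeal (u v : CellType) : Det3 k - 1 ∈ cellIdeal k u v :=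
  Ideal.subset_span (Set.mem_insert _ _)

theorem upperGens_subset_cellIdeal (u v : CellType) : u.upperGens k ⊆ cellIdeal k u v :=
  fun _ hx => Ideal.subset_span (Set.mem_insert_of_mem _ (.inl hx))

theorem lowerGens_subset_cellIdeal (u v : CellType) {x : CoordM3 k} (hx : x ∈ v.upperGens k) :
    transposeM3 k x ∈ cellIdeal k u v :=
  Ideal.subset_span (Set.mem_insert_of_mem _ (.inr ⟨x, hx, rfl⟩))

theorem cellIdeal_eq_varsIdeal {u v : CellType} (hu : u ≠ minor) (hv : v ≠ minor) :
    cellIdeal k u v = varsIdeal (u.upperVars ∪ v.lowerVars) (Det3 k - 1) := by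
  rw [cellIdeal, upperGens_eq k hu, transposeM3_image_upperGens k hv, ← Set.image_union,
    Ideal.span_insert, varsIdeal, sup_comm, Finset.coe_union]

theorem map_mem_of_mem_cellIdeal {F : Type*} [FunLike F (CoordM3 k) (CoordM3 k)]
    [RingHomClass F (CoordM3 k) (CoordM3 k)] (f : F) {u v : CellType} {J : Ideal (CoordM3 k)}
    (hdet : f (Det3 k - 1) ∈ J) (hu : ∀ x ∈ u.upperGens k, f x ∈ J)
    (hv : ∀ x ∈ v.upperGens k, f (transposeM3 k x) ∈ J) :
    ∀ x ∈ cellIdeal k u v, f x ∈ J := by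
  have : cellIdeal k u v ≤ J.comap f := by
    rw [cellIdeal, Ideal.span_le, Set.insert_subset_iff, Set.union_subset_iff,
      Set.image_subset_iff]
    exact ⟨hdet, hu, hv⟩
  exact fun x hx => Ideal.mem_comap.1 (this hx)

theorem transposeM3_mem_cellIdeal (u v : CellType) :
    ∀ x ∈ cellIdeal k u v, transposeM3 k x ∈ cellIdeal k v u := by
  refine map_mem_of_mem_cellIdeal _ ?_ (fun x hx => lowerGens_subset_cellIdeal _ _ hx)
    fun x hx => ?_
  · rw [map_sub, transposeM3_det, map_one]
    exact det_sub_one_mem_cellIdeal _ _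
  · rw [transposeM3_transposeM3]
    exact upperGens_subset_cellIdeal _ _ hx

theorem adjugateM3_transposeM3 (x : CoordM3 k) :
    adjugateM3 k (transposeM3 k x) = transposeM3 k (adjugateM3 k x) := by
  have : (adjugateM3 k).comp (transposeM3 k) = (transposeM3 k).comp (adjugateM3 k) := by
    ext1 ⟨i, j⟩
    have h := (transposeM3 k).map_adjugate (Matrix.mvPolynomialX (Fin 3) (Fin 3) k)
    have h' : (transposeM3 k).mapMatrix (Matrix.mvPolynomialX (Fin 3) (Fin 3) k) =
        (Matrix.mvPolynomialX (Fin 3) (Fin 3) k).transpose := by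
      ext1 i j
      simp [transposeM3]
    rw [h', ← Matrix.adjugate_transpose] at h
    have h := congrFun (congrFun h i) j
    simp only [AlgHom.mapMatrix_apply, Matrix.map_apply, Matrix.transpose_apply] at h
    rw [AlgHom.comp_apply, AlgHom.comp_apply, adjugateM3_X, h]
    simp [transposeM3, adjugateM3_X]
  exact DFunLike.congr_fun this x

/-- Inversion preserves the block triangular and triangular zero patterns, and exchanges the corner
entry with the minor. -/
theorem adjugateM3_mem_span (u : CellType) {x : CoordM3 k} (hx : x ∈ u.upperGens k) :
    adjugateM3 k x ∈ Ideal.span (u.inv.upperGens k) := by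
  obtain ⟨h1, h2, h3, -⟩ := adjugateM3_explicit (k := k)
  have key : ∀ {G : Set (CoordM3 k)} {p q : CoordM3 k} (a b : CoordM3 k), p ∈ G → q ∈ G →
      a * p + b * q ∈ Ideal.span G := fun a b hp hq =>
    add_mem (Ideal.mul_mem_left _ a (Ideal.subset_span hp))
      (Ideal.mul_mem_left _ b (Ideal.subset_span hq))
  cases u
  · exact absurd hx (Set.notMem_empty _)
  · obtain rfl : x = _ := hx
    rw [h2]
    exact Ideal.subset_span rfl
  · obtain rfl : x = _ := hx
    rw [adjugateM3_upperMinor]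
    exact Ideal.mul_mem_left _ _ (Ideal.subset_span rfl)
  · rcases hx with rfl | rfl
    · rw [h1]
      convert key (p := X (0, 1)) (q := X (0, 2)) (-X (2, 2)) (X (2, 1)) _ _ using 1
      · ring
      all_goals simp [inv, upperGens]
    · rw [h2]
      convert key (p := X (0, 1)) (q := X (0, 2)) (X (1, 2)) (-X (1, 1)) _ _ using 1
      · ring
      all_goals simp [inv, upperGens]
  · rcases hx with rfl | rfl
    · rw [h2]
      convert key (p := X (1, 2)) (q := X (0, 2)) (X (0, 1)) (-X (1, 1)) _ _ using 1
      · ring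
      all_goals simp [inv, upperGens]
    · rw [h3]
      convert key (p := X (1, 2)) (q := X (0, 2)) (-X (0, 0)) (X (1, 0)) _ _ using 1
      · ring
      all_goals simp [inv, upperGens]
  · rcases hx with rfl | rfl | rfl
    · rw [h1]
      convert key (p := X (0, 1)) (q := X (0, 2)) (-X (2, 2)) (X (2, 1)) _ _ using 1
      · ring
      all_goals simp [inv, upperGens]
    · rw [h2]
      convert key (p := X (0, 1)) (q := X (0, 2)) (X (1, 2)) (-X (1, 1)) _ _ using 1
      · ring
      all_goals simp [inv, upperGens]
    · rw [h3]
      convert key (p := X (1, 2)) (q := X (0, 2)) (-X (0, 0)) (X (1, 0)) _ _ using 1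
      · ring
      all_goals simp [inv, upperGens]

theorem adjugateM3_mem_cellIdeal (u v : CellType) :
    ∀ x ∈ cellIdeal k u v, adjugateM3 k x ∈ cellIdeal k u.inv v.inv := by
  have hle : Ideal.span (u.inv.upperGens k) ≤ cellIdeal k u.inv v.inv :=
    Ideal.span_le.2 (upperGens_subset_cellIdeal _ _)
  have hle' : Ideal.span (v.inv.upperGens k) ≤
      (cellIdeal k u.inv v.inv).comap (transposeM3 k) :=
    Ideal.span_le.2 fun x hx => Ideal.mem_comap.2 (lowerGens_subset_cellIdeal _ _ hx)
  refine map_mem_of_mem_cellIdeal _ (adjugateM3_det_sub_one_mem (det_sub_one_mem_cellIdeal _ _))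
    (fun x hx => hle (adjugateM3_mem_span u hx)) fun x hx => ?_
  rw [adjugateM3_transposeM3]
  exact Ideal.mem_comap.1 (hle' (adjugateM3_mem_span v hx))

theorem ufd_cellIdeal_swap {u v : CellType}
    (h : IsDomain (CoordM3 k ⧸ cellIdeal k v u) ∧
      UniqueFactorizationMonoid (CoordM3 k ⧸ cellIdeal k v u)) :
    IsDomain (CoordM3 k ⧸ cellIdeal k u v) ∧
      UniqueFactorizationMonoid (CoordM3 k ⧸ cellIdeal k u v) :=
  isDomain_ufd_of_involutive (transposeM3 k).toRingHom
    (transposeM3_mem_cellIdeal u v) (transposeM3_mem_cellIdeal v u)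
    (fun x => (sub_eq_zero.2 (transposeM3_transposeM3 x)).symm ▸ zero_mem _)
    (fun x => (sub_eq_zero.2 (transposeM3_transposeM3 x)).symm ▸ zero_mem _) h

theorem ufd_cellIdeal_inv {u v : CellType}
    (h : IsDomain (CoordM3 k ⧸ cellIdeal k u.inv v.inv) ∧
      UniqueFactorizationMonoid (CoordM3 k ⧸ cellIdeal k u.inv v.inv)) :
    IsDomain (CoordM3 k ⧸ cellIdeal k u v) ∧
      UniqueFactorizationMonoid (CoordM3 k ⧸ cellIdeal k u v) := by
  refine isDomain_ufd_of_involutive (adjugateM3 k).toRingHom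
    (adjugateM3_mem_cellIdeal u v) ?_ (adjugateM3_adjugateM3 (det_sub_one_mem_cellIdeal _ _))
    (adjugateM3_adjugateM3 (det_sub_one_mem_cellIdeal _ _)) h
  have := adjugateM3_mem_cellIdeal (k := k) u.inv v.inv
  rwa [inv_inv, inv_inv] at this

theorem ufd_cellIdeal_corner_minor :
    IsDomain (CoordM3 k ⧸ cellIdeal k corner minor) ∧
      UniqueFactorizationMonoid (CoordM3 k ⧸ cellIdeal k corner minor) := by
  have h : cellIdeal k corner minor = cornerMinorIdeal k := by
    have h1 : transposeM3 k (upperMinor k) = lowerMinor k := by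
      simp [transposeM3, upperMinor, lowerMinor]
      ring
    rw [cellIdeal, cornerMinorIdeal, upperGens, upperGens, Set.image_singleton, h1]
    congr 1
    ext x
    simp
    tauto
  rw [h]
  exact ufd_cornerMinorIdeal

theorem ufd_cellIdeal_of_killVars_diagonal {u v : CellType} (hu : u ≠ minor) (hv : v ≠ minor)
    (h : ∀ i, (i, i) ∉ u.upperVars ∪ v.lowerVars)
    (hq : killVars k (u.upperVars ∪ v.lowerVars) (Det3 k - 1) =
      X (0, 0) * X (1, 1) * X (2, 2) - 1) :
    IsDomain (CoordM3 k ⧸ cellIdeal k u v) ∧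
      UniqueFactorizationMonoid (CoordM3 k ⧸ cellIdeal k u v) := by
  rw [cellIdeal_eq_varsIdeal hu hv]
  exact ufd_of_det_diagonal _ (h 0) (h 1) (h 2) hq

theorem ufd_cellIdeal_of_triangular (v : CellType) (hv : v ≠ minor) :
    IsDomain (CoordM3 k ⧸ cellIdeal k triangular v) ∧
      UniqueFactorizationMonoid (CoordM3 k ⧸ cellIdeal k triangular v) := by
  refine ufd_cellIdeal_of_killVars_diagonal (by simp) hv ?_ ?_
  · cases v <;> decide
  · rw [killVars_det]
    cases v <;> simp [killVars_X, upperVars, lowerVars]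

theorem ufd_cellIdeal_row_column :
    IsDomain (CoordM3 k ⧸ cellIdeal k row column) ∧
      UniqueFactorizationMonoid (CoordM3 k ⧸ cellIdeal k row column) := by
  refine ufd_cellIdeal_of_killVars_diagonal (by simp) (by simp) (by decide) ?_
  rw [killVars_det]
  simp [killVars_X, upperVars, lowerVars]

theorem ufd_cellIdeal_row (v : CellType) (hv : v = generic ∨ v = corner ∨ v = row) :
    IsDomain (CoordM3 k ⧸ cellIdeal k row v) ∧
      UniqueFactorizationMonoid (CoordM3 k ⧸ cellIdeal k row v) := by
  rw [cellIdeal_eq_varsIdeal (by simp) (by rcases hv with rfl | rfl | rfl <;> simp)]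
  refine ufd_of_det_block _ (0, 0) (1, 1) (2, 2) (1, 2) (2, 1) (by decide)
    (by rcases hv with rfl | rfl | rfl <;> decide) ?_
  rw [killVars_det]
  rcases hv with rfl | rfl | rfl <;> simp [killVars_X, upperVars, lowerVars] <;> ring1

theorem ufd_cellIdeal_column (v : CellType) (hv : v = generic ∨ v = corner ∨ v = column) :
    IsDomain (CoordM3 k ⧸ cellIdeal k column v) ∧
      UniqueFactorizationMonoid (CoordM3 k ⧸ cellIdeal k column v) := by
  rw [cellIdeal_eq_varsIdeal (by simp) (by rcases hv with rfl | rfl | rfl <;> simp)]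
  refine ufd_of_det_block _ (2, 2) (0, 0) (1, 1) (0, 1) (1, 0) (by decide)
    (by rcases hv with rfl | rfl | rfl <;> decide) ?_
  rw [killVars_det]
  rcases hv with rfl | rfl | rfl <;> simp [killVars_X, upperVars, lowerVars] <;> ring1

theorem ufd_cellIdeal_corner_generic :
    IsDomain (CoordM3 k ⧸ cellIdeal k corner generic) ∧
      UniqueFactorizationMonoid (CoordM3 k ⧸ cellIdeal k corner generic) := by
  rw [cellIdeal_eq_varsIdeal (by simp) (by simp)]
  exact ufd_kill_02

theorem ufd_cellIdeal_corner_corner :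
    IsDomain (CoordM3 k ⧸ cellIdeal k corner corner) ∧
      UniqueFactorizationMonoid (CoordM3 k ⧸ cellIdeal k corner corner) := by
  rw [cellIdeal_eq_varsIdeal (by simp) (by simp)]
  exact ufd_kill_02_20

/-- Up to transposition, either the determinant takes a diagonal or block shape, or the pair is one
of the two corner cases treated separately. -/
theorem ufd_cellIdeal_of_ne_minor {u v : CellType} (hu : u ≠ minor) (hv : v ≠ minor)
    (huv : ¬ (u = generic ∧ v = generic)) :
    IsDomain (CoordM3 k ⧸ cellIdeal k u v) ∧
      UniqueFactorizationMonoid (CoordM3 k ⧸ cellIdeal k u v) := by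
  have hut := ufd_cellIdeal_of_triangular (k := k) u hu
  have hvt := ufd_cellIdeal_of_triangular (k := k) v hv
  have hrc := ufd_cellIdeal_row_column (k := k)
  have hru := ufd_cellIdeal_row (k := k) u
  have hrv := ufd_cellIdeal_row (k := k) v
  have hcu := ufd_cellIdeal_column (k := k) u
  have hcv := ufd_cellIdeal_column (k := k) v
  have hcg := ufd_cellIdeal_corner_generic (k := k)
  have hcc := ufd_cellIdeal_corner_corner (k := k)
  cases u <;> cases v <;> first
    | exact absurd rfl hu
    | exact absurd rfl hv
    | exact absurd ⟨rfl, rfl⟩ huv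
    | assumption
    | exact ufd_cellIdeal_swap hut
    | exact ufd_cellIdeal_swap hrc
    | exact ufd_cellIdeal_swap hcg
    | exact hrv (by simp)
    | exact hcv (by simp)
    | exact ufd_cellIdeal_swap (hru (by simp))
    | exact ufd_cellIdeal_swap (hcu (by simp))

/-- The polynomial is linear in `x₃₃`, its leading coefficient is the prime leading minor, and the
remaining part has constant term `-1`, so the minor does not divide it. -/
theorem prime_det_sub_one : Prime (Det3 k - 1) := by
  have hminor : Prime (X (0, 0) * X (1, 1) - X (0, 1) * X (1, 0) : CoordM3 k) := by
    have h := prime_prod_X_mul_X_add (R := k) ({(0, 0)} : Finset (Fin 3 × Fin 3)) (1, 1) 1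
      (-(X (0, 1) * X (1, 0))) (by decide)
      (by apply_rules [neg_mem, mul_mem, X_mem_supported.2] <;> simp)
      (by simp [killVars_X])
    convert h using 1
    simp
    ring
  have h := prime_mul_X_add (R := k) (s := {((2 : Fin 3), (2 : Fin 3))}ᶜ) (j := (2, 2)) (by simp)
    (a := X (0, 0) * X (1, 1) - X (0, 1) * X (1, 0))
    (b := - (X (0, 0) * X (1, 2) * X (2, 1)) + X (0, 1) * X (1, 2) * X (2, 0)
      + X (0, 2) * X (1, 0) * X (2, 1) - X (0, 2) * X (1, 1) * X (2, 0) - 1)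
    (by apply_rules [sub_mem, add_mem, neg_mem, mul_mem, one_mem, X_mem_supported.2] <;> simp)
    (by apply_rules [sub_mem, add_mem, neg_mem, mul_mem, one_mem, X_mem_supported.2] <;> simp)
    hminor.ne_zero (by
      rw [hminor.irreducible.isRelPrime_iff_not_dvd]
      rintro ⟨c, hc⟩
      simpa using congrArg constantCoeff hc)
  convert h using 1
  rw [det3_eq]
  ring

theorem ufd_cellIdeal_minor_generic :
    IsDomain (CoordM3 k ⧸ cellIdeal k minor generic) ∧
      UniqueFactorizationMonoid (CoordM3 k ⧸ cellIdeal k minor generic) :=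
  ufd_cellIdeal_inv ufd_cellIdeal_corner_generic

/-- The coordinates `x₁₁, x₁₂, x₁₃, x₂₁, x₂₃, x₃₂, x₃₃` and the minor on rows 1, 2 and columns
2, 3, which are coordinates on an open subset of `SL₃`. -/
noncomputable def openChart (k : Type*) [Field k] : Fin 8 → CoordM3 k :=
  ![X (0, 0), X (0, 1), X (0, 2), X (1, 0), X (1, 2), X (2, 1), X (2, 2), upperMinor k]

/-- The generic matrix of `SL₃` in terms of the coordinates `openChart`. -/
noncomputable def ofOpenChart (k : Type*) [Field k] :
    CoordM3 k →ₐ[k] FractionRing (MvPolynomial (Fin 8) k) :=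
  let t : Fin 8 → FractionRing (MvPolynomial (Fin 8) k) := fun i =>
    algebraMap (MvPolynomial (Fin 8) k) _ (X i)
  -- `x₂₂` is solved from the definition of the minor, and `x₃₁` from `Det = 1`, where its
  -- coefficient is that minor.
  let x : FractionRing (MvPolynomial (Fin 8) k) := (t 1 * t 4 - t 7) / t 2
  let M : Matrix (Fin 3) (Fin 3) (FractionRing (MvPolynomial (Fin 8) k)) :=
    !![t 0, t 1, t 2; t 3, x, t 4;
      (1 + t 5 * (t 0 * t 4 - t 2 * t 3) - t 6 * (t 0 * x - t 1 * t 3)) / t 7, t 5, t 6]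
  aeval fun i => M i.1 i.2

theorem algebraMap_X_ne_zero (i : Fin 8) :
    algebraMap (MvPolynomial (Fin 8) k) (FractionRing (MvPolynomial (Fin 8) k)) (X i) ≠ 0 := by
  rw [Ne, FaithfulSMul.algebraMap_eq_zero_iff]
  exact X_ne_zero i

theorem ofOpenChart_det : ofOpenChart k (Det3 k) = 1 := by
  have h2 := algebraMap_X_ne_zero (k := k) 2
  have h7 := algebraMap_X_ne_zero (k := k) 7
  simp [det3_eq, ofOpenChart]
  field_simp
  ring

/-- This makes the eight coordinates algebraically independent modulo `Det - 1`. -/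
theorem ofOpenChart_openChart (p : MvPolynomial (Fin 8) k) :
    ofOpenChart k (aeval (openChart k) p) = algebraMap _ _ p := by
  have : (ofOpenChart k).comp (aeval (openChart k)) =
      IsScalarTower.toAlgHom k (MvPolynomial (Fin 8) k) _ := by
    have h2 := algebraMap_X_ne_zero (k := k) 2
    ext1 i
    fin_cases i <;> simp [ofOpenChart, openChart, upperMinor]
    field_simp
    ring
  exact DFunLike.congr_fun this p

theorem cellIdeal_sup_span_upperGens {u : CellType} {x : CoordM3 k} (hx : u.upperGens k = {x}) :
    cellIdeal k generic generic ⊔ Ideal.span {x} = cellIdeal k u generic := by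
  rw [cellIdeal, cellIdeal, hx, ← Ideal.span_union]
  simp [upperGens, Set.pair_comm]

/-- Modulo `x`, the ring of `SL₃` becomes the ring of the cell closure `u`, which is a domain. -/
theorem prime_mk_of_isDomain {u : CellType} {x : CoordM3 k} (hx : u.upperGens k = {x})
    (h : IsDomain (CoordM3 k ⧸ cellIdeal k u generic)) (hx0 : x ∉ cellIdeal k generic generic) :
    Prime (Ideal.Quotient.mk (cellIdeal k generic generic) x) := by
  rw [← Ideal.span_singleton_prime (mt Ideal.Quotient.eq_zero_iff_mem.1 hx0)]
  have hP : (cellIdeal k u generic).IsPrime := (Ideal.Quotient.isDomain_iff_prime _).1 h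
  rw [← Set.image_singleton, ← Ideal.map_span]
  have h1 : (Ideal.span {x}).map (Ideal.Quotient.mk (cellIdeal k generic generic)) =
      (cellIdeal k u generic).map (Ideal.Quotient.mk (cellIdeal k generic generic)) := by
    rw [← cellIdeal_sup_span_upperGens hx, Ideal.map_sup, Ideal.map_quotient_self, bot_sup_eq]
  rw [h1]
  refine Ideal.map_isPrime_of_surjective Ideal.Quotient.mk_surjective ?_
  rw [Ideal.mk_ker, ← cellIdeal_sup_span_upperGens hx]
  exact le_sup_left

/-- Nagata's criterion with the two primes `x₁₃` and the upper minor: multiplying by them brings the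
remaining entries `x₂₂` and `x₃₁` into the polynomial ring on the chart. -/
theorem ufd_cellIdeal_generic :
    IsDomain (CoordM3 k ⧸ cellIdeal k generic generic) ∧
      UniqueFactorizationMonoid (CoordM3 k ⧸ cellIdeal k generic generic) := by
  have hJ : cellIdeal k generic generic = Ideal.span {Det3 k - 1} := by
    simp [cellIdeal, upperGens]
  have hker : ∀ x ∈ cellIdeal k generic generic, ofOpenChart k x = 0 := by
    have : cellIdeal k generic generic ≤ RingHom.ker (ofOpenChart k) := by
      rw [hJ, Ideal.span_le, Set.singleton_subset_iff, SetLike.mem_coe, RingHom.mem_ker, map_sub,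
        ofOpenChart_det, map_one, sub_self]
    exact this
  have hdom : IsDomain (CoordM3 k ⧸ cellIdeal k generic generic) := by
    rw [Ideal.Quotient.isDomain_iff_prime, hJ]
    exact (Ideal.span_singleton_prime prime_det_sub_one.ne_zero).2 prime_det_sub_one
  refine ⟨hdom, ?_⟩
  have hchart : ∀ p, aeval (R := k) (openChart k) p ∈ cellIdeal k generic generic →
      p = 0 := by
    intro p hp
    have := hker _ hp
    rwa [ofOpenChart_openChart, FaithfulSMul.algebraMap_eq_zero_iff] at this
  let mk := Ideal.Quotient.mkₐ k (cellIdeal k generic generic)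
  let φ : MvPolynomial (Fin 8) k →ₐ[k] CoordM3 k ⧸ cellIdeal k generic generic :=
    mk.comp (aeval (openChart k))
  have hφX : ∀ i, φ (X i) = mk (openChart k i) := fun i => by simp [φ]
  have h2 : φ (X 2) = mk (X (0, 2)) := hφX 2
  have h7 : φ (X 7) = mk (upperMinor k) := hφX 7
  have hne : ∀ i, openChart k i ∉ cellIdeal k generic generic := fun i hi =>
    X_ne_zero i (hchart (X i) (by simpa using hi))
  refine UniqueFactorizationMonoid.of_nagata φ.toRingHom ?_ {φ (X 2), φ (X 7)} ?_ ?_ ?_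
  · rw [injective_iff_map_eq_zero]
    exact fun p hp => hchart p (Ideal.Quotient.eq_zero_iff_mem.1 hp)
  · rintro x (rfl | rfl)
    · rw [h2]
      exact .inl (prime_mk_of_isDomain (u := corner) rfl ufd_cellIdeal_corner_generic.1 (hne 2))
    · rw [h7]
      exact .inl (prime_mk_of_isDomain (u := minor) rfl ufd_cellIdeal_minor_generic.1 (hne 7))
  · rintro x (rfl | rfl) <;> exact ⟨_, rfl⟩
  · have hm2 : φ (X 2) ∈ Submonoid.closure {φ (X 2), φ (X 7)} := Submonoid.subset_closure (.inl rfl)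
    have hm7 : φ (X 7) ∈ Submonoid.closure {φ (X 2), φ (X 7)} := Submonoid.subset_closure (.inr rfl)
    set M := Submonoid.closure {φ (X 2), φ (X 7)}
    have hM : M ≤ φ.range.toSubmonoid := Submonoid.closure_le.2 (by
      rintro x (rfl | rfl) <;> exact ⟨_, rfl⟩)
    have hX : ∀ i, mk (openChart k i) ∈ φ.range.saturation M hM := fun i =>
      Subalgebra.le_saturation ⟨X i, hφX i⟩
    have h11 : mk (X (1, 1)) ∈ φ.range.saturation M hM := by
      refine Subalgebra.mem_saturation_of_mul_mem_left (x := φ (X 2)) ?_ hm2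
      have : φ (X 2) * mk (X (1, 1)) =
          mk (openChart k 1) * mk (openChart k 4) - mk (openChart k 7) := by
        simp only [h2, openChart, upperMinor, Matrix.cons_val, ← map_mul, ← map_sub]
        congr 1
        ring
      rw [this]
      exact sub_mem (mul_mem (hX 1) (hX 4)) (hX 7)
    have h20 : mk (X (2, 0)) ∈ φ.range.saturation M hM := by
      refine Subalgebra.mem_saturation_of_mul_mem_left (x := φ (X 7)) ?_ hm7
      have hdet : mk (Det3 k - 1) = 0 :=
        Ideal.Quotient.eq_zero_iff_mem.2 (det_sub_one_mem_cellIdeal _ _)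
      have : φ (X 7) * mk (X (2, 0)) = 1 + mk (openChart k 5) *
          (mk (openChart k 0) * mk (openChart k 4) - mk (openChart k 2) * mk (openChart k 3))
          - mk (openChart k 6) *
          (mk (openChart k 0) * mk (X (1, 1)) - mk (openChart k 1) * mk (openChart k 3)) := by
        rw [det3_eq] at hdet
        simp only [map_sub, map_add, map_mul, map_one] at hdet
        simp only [h7, openChart, upperMinor, Matrix.cons_val, map_mul, map_sub]
        linear_combination hdet
      rw [this]
      exact sub_mem (add_mem (one_mem _) (mul_mem (hX 5)
        (sub_mem (mul_mem (hX 0) (hX 4)) (mul_mem (hX 2) (hX 3)))))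
        (mul_mem (hX 6) (sub_mem (mul_mem (hX 0) h11) (mul_mem (hX 1) (hX 3))))
    have hall : ∀ f, mk f ∈ φ.range.saturation M hM := by
      intro f
      induction f using MvPolynomial.induction_on with
      | C r => exact Subalgebra.algebraMap_mem _ r
      | add p q hp hq => exact map_add mk p q ▸ add_mem hp hq
      | mul_X p i hp =>
        rw [map_mul]
        refine mul_mem hp ?_
        obtain ⟨i, j⟩ := i
        fin_cases i <;> fin_cases j
        exacts [hX 0, hX 1, hX 2, hX 3, h11, hX 4, h20, hX 5, hX 6]
    intro f
    obtain ⟨f, rfl⟩ := Ideal.Quotient.mk_surjective f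
    obtain ⟨m, hm, g, hg⟩ := hall f
    exact ⟨m, hm, g, hg.symm⟩

theorem ufd_cellIdeal (u v : CellType) :
    IsDomain (CoordM3 k ⧸ cellIdeal k u v) ∧
      UniqueFactorizationMonoid (CoordM3 k ⧸ cellIdeal k u v) := by
  by_cases huv : u = generic ∧ v = generic
  · obtain ⟨rfl, rfl⟩ := huv
    exact ufd_cellIdeal_generic
  by_cases h1 : u = minor
  · subst h1
    by_cases h2 : v = corner
    · subst h2
      exact ufd_cellIdeal_swap ufd_cellIdeal_corner_minor
    -- Inversion turns `minor` into `corner`; the other type becomes `minor` only if it was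
    -- `corner`, which is excluded here.
    · apply ufd_cellIdeal_inv
      apply ufd_cellIdeal_of_ne_minor <;> cases v <;> simp_all [inv]
  by_cases h2 : v = minor
  · subst h2
    by_cases h2 : u = corner
    · subst h2
      exact ufd_cellIdeal_corner_minor
    · apply ufd_cellIdeal_inv
      apply ufd_cellIdeal_of_ne_minor <;> cases u <;> simp_all [inv]
  exact ufd_cellIdeal_of_ne_minor h1 h2 huv

end Cells

/-! ### Minimal primes over ideals stable under a derivation -/

section MinimalPrimes

variable {A : Type*} [CommRing A]

/-- Otherwise some prime over `I` would avoid both `f` and the complement of `P`, contradicting the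
minimality of `P`. -/
theorem Ideal.exists_mul_pow_mem_of_mem_minimalPrimes {I P : Ideal A} (hP : P ∈ I.minimalPrimes)
    {f : A} (hf : f ∈ P) : ∃ s ∉ P, ∃ n, s * f ^ n ∈ I := by
  have := hP.1.1
  by_contra! h
  have hdisj : Disjoint (I : Set A) (P.primeCompl ⊔ Submonoid.powers f : Submonoid A) := by
    rw [Set.disjoint_left]
    intro x hx hx'
    obtain ⟨s, hs, _, ⟨n, rfl⟩, rfl⟩ := Submonoid.mem_sup.1 hx'
    exact h s hs n hx
  obtain ⟨Q, hQ, hIQ, hQd⟩ := Ideal.exists_le_prime_disjoint I _ hdisj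
  rw [Set.disjoint_left] at hQd
  have hQP : Q ≤ P := fun x hx => by
    by_contra hxP
    exact hQd hx (Submonoid.mem_sup_left (S := P.primeCompl) hxP)
  exact hQd (hP.2 ⟨hQ, hIQ⟩ hQP hf) (Submonoid.mem_sup_right (Submonoid.mem_powers f))

/-- In characteristic zero, the minimal primes over an ideal stable under a derivation are
stable under it. -/
theorem Ideal.derivation_mem_of_mem_minimalPrimes {k : Type*} [Field k] [CharZero k] [Algebra k A]
    (δ : Derivation k A A) {I P : Ideal A} (hI : ∀ u ∈ I, δ u ∈ I) (hP : P ∈ I.minimalPrimes)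
    {f : A} (hf : f ∈ P) : δ f ∈ P := by
  have hprime := hP.1.1
  obtain ⟨s, hs, n, hsn⟩ := exists_mul_pow_mem_of_mem_minimalPrimes hP hf
  -- The induction trades powers of `f` for powers of `δ f`, at the cost of enlarging `s`.
  suffices H : ∀ n m s, s ∉ P → s * f ^ n * δ f ^ m ∈ I → δ f ∈ P from
    H n 0 s hs (by simpa using hsn)
  clear hs hsn s n
  intro n
  induction n with
  | zero =>
    intro m s hs h
    rw [pow_zero, mul_one] at h
    exact hprime.mem_of_pow_mem m ((hprime.mem_or_mem (hP.1.2 h)).resolve_left hs)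
  | succ n ih =>
    intro m s hs h
    refine ih (m + 2) (s * s) (fun hss => hs (by simpa using hprime.mem_or_mem hss)) ?_
    have h1 := hI _ h
    have h2 : ((n + 1 : ℕ) : A) * (s * s * f ^ n * δ f ^ (m + 2)) ∈ I := by
      -- Multiplying the derivative by `s * δ f` makes its two unwanted terms multiples of the
      -- original element of `I`.
      have h3 : ((n + 1 : ℕ) : A) * (s * s * f ^ n * δ f ^ (m + 2)) =
          s * δ f * δ (s * f ^ (n + 1) * δ f ^ m) - δ s * δ f * (s * f ^ (n + 1) * δ f ^ m)
          - m * s * δ (δ f) * (s * f ^ (n + 1) * δ f ^ m) := by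
        rcases m with _ | m
        · simp only [Derivation.leibniz, Derivation.leibniz_pow, smul_eq_mul, nsmul_eq_mul,
            Nat.add_sub_cancel]
          push_cast
          simp
          ring
        · simp only [Derivation.leibniz, Derivation.leibniz_pow, smul_eq_mul, nsmul_eq_mul,
            Nat.add_sub_cancel]
          push_cast
          ring
      rw [h3]
      exact sub_mem (sub_mem (I.mul_mem_left _ h1) (I.mul_mem_left _ h)) (I.mul_mem_left _ h)
    have hunit : IsUnit ((n + 1 : ℕ) : A) := by
      have := (IsUnit.mk0 ((n + 1 : ℕ) : k) (Nat.cast_ne_zero.2 n.succ_ne_zero)).map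
        (algebraMap k A)
      rwa [map_natCast] at this
    exact (I.unit_mul_mem_iff_mem hunit).1 h2

end MinimalPrimes

/-! ### Poisson `H`-primes are prime ideals -/

section SL3

variable {k : Type*} [Field k]

theorem bracketM3_smul_left (c : k) (f g : CoordM3 k) :
    bracketM3 k (c • f) g = c • bracketM3 k f g := by
  simp only [bracketM3, Derivation.map_smul, Finset.smul_sum, smul_mul_assoc, mul_smul_comm]

/-- The Hamiltonian derivation `{·, v}` of `O(SL₃)`. -/
noncomputable def hamiltonianSL3 (v : CoordSL3 k) : Derivation k (CoordSL3 k) (CoordSL3 k) :=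
  Derivation.mk'
    { toFun := fun u => bracketSL3 k u v
      map_add' := fun u w => by
        obtain ⟨u, rfl⟩ := Ideal.Quotient.mk_surjective u
        obtain ⟨w, rfl⟩ := Ideal.Quotient.mk_surjective w
        obtain ⟨v, rfl⟩ := Ideal.Quotient.mk_surjective v
        rw [← map_add, bracketSL3_mk, bracketSL3_mk, bracketSL3_mk, bracketM3_add_left, map_add]
      map_smul' := fun c u => by
        obtain ⟨u, rfl⟩ := Ideal.Quotient.mk_surjective u
        obtain ⟨v, rfl⟩ := Ideal.Quotient.mk_surjective v
        change bracketSL3 k (Ideal.Quotient.mk _ (c • u)) _ =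
          c • Ideal.Quotient.mk _ (bracketM3 k u v)
        rw [bracketSL3_mk, bracketM3_smul_left]
        rfl }
    fun u w => by
      obtain ⟨u, rfl⟩ := Ideal.Quotient.mk_surjective u
      obtain ⟨w, rfl⟩ := Ideal.Quotient.mk_surjective w
      obtain ⟨v, rfl⟩ := Ideal.Quotient.mk_surjective v
      simp only [LinearMap.coe_mk, AddHom.coe_mk, smul_eq_mul]
      rw [← map_mul, bracketSL3_mk, bracketSL3_mk, bracketSL3_mk, bracketM3_mul_left, map_add,
        map_mul, map_mul]

theorem actSL3_mk (h : torusSL3 k) (f : CoordM3 k) :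
    actSL3 k h (Ideal.Quotient.mk _ f) = Ideal.Quotient.mk _ (actM3 k h.1 f) := rfl

theorem actSL3_mul (g h : torusSL3 k) (u : CoordSL3 k) :
    actSL3 k (g * h) u = actSL3 k g (actSL3 k h u) := by
  obtain ⟨f, rfl⟩ := Ideal.Quotient.mk_surjective u
  rw [actSL3_mk, actSL3_mk, actSL3_mk]
  congr 1
  have : actM3 k (g * h).1 = (actM3 k g.1).comp (actM3 k h.1) := by
    ext1 p
    simp [actM3]
    ring
  exact DFunLike.congr_fun this f

theorem actSL3_one (u : CoordSL3 k) : actSL3 k 1 u = u := by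
  obtain ⟨f, rfl⟩ := Ideal.Quotient.mk_surjective u
  rw [actSL3_mk]
  congr 1
  have : actM3 k (1 : torusSL3 k).1 = AlgHom.id k _ := by
    ext1 p
    simp [actM3]
  exact DFunLike.congr_fun this f

theorem isTorusStable_iff {I : Ideal (CoordSL3 k)} :
    IsTorusStable I ↔ ∀ h, ∀ u ∈ I, actSL3 k h u ∈ I := by
  refine ⟨fun hI h u hu => ?_, fun hI h => ?_⟩
  · have : actSL3 k h u ∈ actSL3 k h '' (I : Set (CoordSL3 k)) := ⟨u, hu, rfl⟩
    rwa [hI h] at this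
  · refine Set.Subset.antisymm (Set.image_subset_iff.2 (hI h)) fun u hu => ?_
    exact ⟨actSL3 k h⁻¹ u, hI _ u hu, by rw [← actSL3_mul, mul_inv_cancel, actSL3_one]⟩

/-- Roots are chosen freely for five coordinates; the relation then determines the sixth. -/
theorem exists_pow_eq_of_mem_torusSL3 [IsAlgClosed k] (h : torusSL3 k) {n : ℕ} (hn : 0 < n) :
    ∃ g : torusSL3 k, g ^ n = h := by
  have hroot : ∀ x : kˣ, ∃ y : kˣ, y ^ n = x := fun x => by
    obtain ⟨y, hy⟩ := IsAlgClosed.exists_pow_nat_eq (x : k) hn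
    have hy0 : y ≠ 0 := by
      rintro rfl
      rw [zero_pow hn.ne'] at hy
      exact x.ne_zero hy.symm
    exact ⟨Units.mk0 y hy0, Units.ext (by simpa using hy)⟩
  choose r hr using hroot
  obtain ⟨⟨a, b⟩, hab⟩ := h
  have hab' : (∏ i, a i) * (∏ j, b j) = 1 := hab
  rw [Fin.prod_univ_three b] at hab'
  have hb2 : b 2 = ((∏ i, a i) * (b 0 * b 1))⁻¹ := by
    rw [eq_comm, inv_eq_iff_mul_eq_one, mul_assoc, hab']
  refine ⟨⟨(fun i => r (a i), ![r (b 0), r (b 1), ((∏ i, r (a i)) * (r (b 0) * r (b 1)))⁻¹]), ?_⟩,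
    ?_⟩
  · change (∏ i, r (a i)) * (∏ j, _) = 1
    simp only [Fin.prod_univ_three, Matrix.cons_val]
    group
  · refine Subtype.ext (Prod.ext ?_ ?_)
    · funext i
      simp [hr]
    · funext j
      fin_cases j
      · simp [hr]
      · simp [hr]
      · simp [hb2, mul_pow, ← Finset.prod_pow, hr]

/-- The torus permutes the finitely many minimal primes over `I`. Every torus element is a power
with exponent the order of that permutation group, so it acts trivially. -/
theorem IsTorusStable.of_mem_minimalPrimes [IsAlgClosed k] {I P : Ideal (CoordSL3 k)}
    (hI : IsTorusStable I) (hP : P ∈ I.minimalPrimes) : IsTorusStable P := by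
  rw [isTorusStable_iff] at hI ⊢
  have hfin : Finite I.minimalPrimes := (I.finite_minimalPrimes_of_isNoetherianRing).to_subtype
  have hcomap : ∀ (g : torusSL3 k) (Q : Ideal (CoordSL3 k)), Q ∈ I.minimalPrimes →
      Q.comap (actSL3 k g) ∈ I.minimalPrimes := by
    intro g Q hQ
    have := hQ.1.1
    refine ⟨⟨inferInstance, fun u hu => hQ.1.2 (hI g u hu)⟩, ?_⟩
    rintro J ⟨hJ, hIJ⟩ hle u hu
    have h1 := hQ.2 (y := J.comap (actSL3 k g⁻¹)) ⟨inferInstance, fun u hu => hIJ (hI _ u hu)⟩ (by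
      intro w hw
      have h2 := hle hw
      rwa [Ideal.mem_comap, ← actSL3_mul, mul_inv_cancel, actSL3_one] at h2)
    have h2 := h1 hu
    rwa [Ideal.mem_comap, ← actSL3_mul, inv_mul_cancel, actSL3_one] at h2
  let φ : torusSL3 k →* Equiv.Perm I.minimalPrimes :=
    MonoidHom.toHomPerm
      { toFun := fun g Q => ⟨Q.1.comap (actSL3 k g⁻¹), hcomap _ _ Q.2⟩
        map_one' := by
          funext Q
          refine Subtype.ext (Ideal.ext fun u => ?_)
          simp only [Ideal.mem_comap, inv_one, actSL3_one]
          rfl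
        map_mul' := fun g h => by
          funext Q
          refine Subtype.ext (Ideal.ext fun u => ?_)
          simp only [Ideal.mem_comap, mul_inv_rev, actSL3_mul]
          rfl }
  intro h u hu
  obtain ⟨g, hg⟩ := exists_pow_eq_of_mem_torusSL3 h⁻¹ (n := Nat.card (Equiv.Perm I.minimalPrimes))
    Nat.card_pos
  have h1 : φ h⁻¹ = 1 := by rw [← hg, map_pow, pow_card_eq_one']
  have h2 : P.comap (actSL3 k h⁻¹⁻¹) = P := congrArg (fun σ => (σ ⟨P, hP⟩).1) h1
  rw [_root_.inv_inv] at h2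
  rw [← h2] at hu
  exact hu

theorem IsPoissonIdeal.of_mem_minimalPrimes [CharZero k] {I P : Ideal (CoordSL3 k)}
    (hI : IsPoissonIdeal I) (hP : P ∈ I.minimalPrimes) : IsPoissonIdeal P := fun _ hu v =>
  Ideal.derivation_mem_of_mem_minimalPrimes (hamiltonianSL3 v) (fun w hw => hI w hw v) hP hu

theorem IsPoissonIdeal.mul {J K : Ideal (CoordSL3 k)} (hJ : IsPoissonIdeal J)
    (hK : IsPoissonIdeal K) : IsPoissonIdeal (J * K) := by
  intro u hu v
  change hamiltonianSL3 v u ∈ J * K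
  induction hu using Submodule.mul_induction_on' with
  | mem_mul_mem a ha b hb =>
    rw [Derivation.leibniz, smul_eq_mul, smul_eq_mul, mul_comm b]
    exact add_mem (Ideal.mul_mem_mul ha (hK b hb v)) (Ideal.mul_mem_mul (hJ a ha v) hb)
  | add a _ b _ ha hb =>
    rw [map_add]
    exact add_mem ha hb

theorem IsTorusStable.mul {J K : Ideal (CoordSL3 k)} (hJ : IsTorusStable J)
    (hK : IsTorusStable K) : IsTorusStable (J * K) := by
  rw [isTorusStable_iff] at hJ hK ⊢
  intro h u hu
  induction hu using Submodule.mul_induction_on' with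
  | mem_mul_mem a ha b hb =>
    rw [map_mul]
    exact Ideal.mul_mem_mul (hJ h a ha) (hK h b hb)
  | add a _ b _ ha hb =>
    rw [map_add]
    exact add_mem ha hb

theorem isPoissonIdeal_top : IsPoissonIdeal (⊤ : Ideal (CoordSL3 k)) := fun _ _ _ => trivial

theorem isTorusStable_top : IsTorusStable (⊤ : Ideal (CoordSL3 k)) :=
  isTorusStable_iff.2 fun _ _ _ => trivial

theorem IsPoissonHPrime.exists_le_of_prod_le {I : Ideal (CoordSL3 k)} (hI : IsPoissonHPrime I)
    (s : Multiset (Ideal (CoordSL3 k))) (hs : ∀ J ∈ s, IsPoissonIdeal J ∧ IsTorusStable J)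
    (h : s.prod ≤ I) : ∃ J ∈ s, J ≤ I := by
  have hprod : ∀ s : Multiset (Ideal (CoordSL3 k)),
      (∀ J ∈ s, IsPoissonIdeal J ∧ IsTorusStable J) →
        IsPoissonIdeal s.prod ∧ IsTorusStable s.prod := by
    intro s hs
    refine Multiset.prod_induction _ s ?_ ?_ hs
    · exact fun J K hJ hK => ⟨hJ.1.mul hK.1, hJ.2.mul hK.2⟩
    · rw [Ideal.one_eq_top]
      exact ⟨isPoissonIdeal_top, isTorusStable_top⟩
  induction s using Multiset.induction_on with
  | empty =>
    rw [Multiset.prod_zero, Ideal.one_eq_top, top_le_iff] at h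
    exact absurd h hI.ne_top
  | cons J s ih =>
    have hJ := hs J (Multiset.mem_cons_self J s)
    have hs' := fun K hK => hs K (Multiset.mem_cons_of_mem hK)
    rw [Multiset.prod_cons] at h
    rcases hI.mem_or_mem J _ hJ.1 hJ.2 (hprod s hs').1 (hprod s hs').2 h with h | h
    · exact ⟨J, Multiset.mem_cons_self J s, h⟩
    · obtain ⟨K, hK, hKI⟩ := ih hs' h
      exact ⟨K, Multiset.mem_cons_of_mem hK, hKI⟩

/-- Poisson `H`-primes are prime. -/
theorem IsPoissonHPrime.isPrime [IsAlgClosed k] [CharZero k] {I : Ideal (CoordSL3 k)}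
    (hI : IsPoissonHPrime I) : I.IsPrime := by
  have hmin : ∀ P ∈ I.minimalPrimes, IsPoissonIdeal P ∧ IsTorusStable P := fun P hP =>
    ⟨hI.poisson.of_mem_minimalPrimes hP, hI.stable.of_mem_minimalPrimes hP⟩
  have hfin := I.finite_minimalPrimes_of_isNoetherianRing
  -- The product of the minimal primes lies in the radical, so its `n`-th power lies in `I` and some
  -- minimal prime does too.
  obtain ⟨n, hn⟩ := I.exists_radical_pow_le_of_fg (IsNoetherian.noetherian _)
  obtain ⟨P, hP, hPI⟩ := hI.exists_le_of_prod_le (n • hfin.toFinset.val) (by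
    intro P hP
    exact hmin P (hfin.mem_toFinset.1 (Multiset.mem_of_mem_nsmul hP))) (by
    rw [Multiset.prod_nsmul]
    refine (Ideal.pow_right_mono ?_ n).trans hn
    rw [← Ideal.sInf_minimalPrimes]
    refine le_sInf fun P hP => ?_
    refine Ideal.le_of_dvd (Multiset.dvd_prod ?_)
    exact hfin.mem_toFinset.2 hP)
  have hP' := hfin.mem_toFinset.1 (Multiset.mem_of_mem_nsmul hP)
  rw [le_antisymm hP'.1.2 hPI]
  exact hP'.1.1

end SL3

/-! ### Ideals stable under operators diagonal on monomials -/

section DiagonalOperators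

variable {k : Type*} [Field k] {ι : Type*}

/-- A prime ideal of a polynomial ring that contains no variable and is stable under diagonal
operators separating the monomials is zero. -/
theorem eq_zero_of_diagonal_operators (K : Ideal (MvPolynomial ι k)) (hK : K.IsPrime)
    (hX : ∀ i, X i ∉ K) {Λ : Type*} (g : Λ → (ι →₀ ℕ) → k)
    (hg : ∀ l, ∀ p ∈ K, ∃ q ∈ K, ∀ a, coeff a q = g l a * coeff a p)
    (hsep : ∀ a b, (∀ l, g l a = g l b) → a = b) : ∀ p ∈ K, p = 0 := by
  classical
  intro p
  induction hn : p.support.card using Nat.strong_induction_on generalizing p with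
  | _ n ih =>
    subst hn
    intro hp
    by_contra hp0
    obtain ⟨a, ha⟩ := support_nonempty.2 hp0
    by_cases hb : ∃ b ∈ p.support, b ≠ a
    · obtain ⟨b, hb, hba⟩ := hb
      have : ∃ l, g l b ≠ g l a := by
        by_contra! h
        exact hba (hsep b a h)
      obtain ⟨l, hl⟩ := this
      -- Subtracting `g l a` times `p` removes the monomial `a` but keeps `b`, which contradicts the
      -- vanishing of polynomials with smaller support.
      obtain ⟨q, hq, hqc⟩ := hg l p hp
      have hcoeff : ∀ c, coeff c (q - C (g l a) * p) = (g l c - g l a) * coeff c p := fun c => by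
        rw [coeff_sub, coeff_C_mul, hqc]
        ring
      have hlt : (q - C (g l a) * p).support.card < p.support.card := by
        refine Finset.card_lt_card (Finset.ssubset_iff_of_subset ?_ |>.2 ⟨a, ha, ?_⟩)
        · intro c hc
          rw [mem_support_iff, hcoeff] at hc
          exact mem_support_iff.2 (right_ne_zero_of_mul hc)
        · rw [notMem_support_iff, hcoeff, sub_self, zero_mul]
      have h0 := ih _ hlt _ rfl (sub_mem hq (K.mul_mem_left _ hp))
      have h1 := hcoeff b
      rw [h0, coeff_zero, eq_comm, mul_eq_zero, sub_eq_zero] at h1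
      exact h1.elim hl (mem_support_iff.1 hb)
    · push Not at hb
      have hpa : p = monomial a (coeff a p) := by
        ext c
        rw [coeff_monomial]
        split_ifs with h
        · rw [h]
        · exact notMem_support_iff.1 fun hc => h (hb c hc).symm
      rw [hpa, monomial_eq] at hp
      rcases hK.mem_or_mem hp with h | h
      · exact hK.ne_top (K.eq_top_of_isUnit_mem h ((IsUnit.mk0 _ (mem_support_iff.1 ha)).map C))
      · rw [Finsupp.prod, hK.prod_mem_iff] at h
        obtain ⟨i, -, hi⟩ := h
        exact hX i (hK.mem_of_pow_mem _ hi)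

theorem coeff_aeval_C_mul_X [Fintype ι] (χ : ι → k) (p : MvPolynomial ι k) (a : ι →₀ ℕ) :
    coeff a (aeval (fun i => C (χ i) * X i) p : MvPolynomial ι k) =
      (∏ i, χ i ^ a i) * coeff a p := by
  classical
  induction p using MvPolynomial.induction_on' with
  | monomial b c =>
    have : aeval (fun i => C (χ i) * X i) (monomial b c) =
        C (∏ i, χ i ^ b i) * monomial b c := by
      rw [aeval_monomial, monomial_eq, Finsupp.prod_fintype _ _ (by simp),
        Finsupp.prod_fintype _ _ (by simp)]
      simp only [mul_pow, Finset.prod_mul_distrib, map_prod, map_pow, algebraMap_eq]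
      ring
    rw [this, coeff_C_mul, coeff_monomial]
    split_ifs with h
    · rw [h]
    · simp
  | add p q hp hq => rw [map_add, coeff_add, coeff_add, hp, hq, mul_add]

theorem coeff_mkDerivation_C_mul_X [Fintype ι] (π : ι → k) (p : MvPolynomial ι k) (a : ι →₀ ℕ) :
    coeff a (mkDerivation k (fun i => C (π i) * X i) p : MvPolynomial ι k) =
      (∑ i, π i * a i) * coeff a p := by
  classical
  induction p using MvPolynomial.induction_on' with
  | monomial b c =>
    have : mkDerivation k (fun i => C (π i) * X i) (monomial b c) =
        C (∑ i, π i * b i) * monomial b c := by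
      rw [mkDerivation_monomial, Finsupp.sum_fintype _ _ (by simp), map_sum, Finset.smul_sum,
        Finset.sum_mul]
      refine Finset.sum_congr rfl fun i _ => ?_
      rcases Nat.eq_zero_or_pos (b i) with h | h
      · simp [h]
      · have hb : b - Finsupp.single i 1 + Finsupp.single i 1 = b :=
          tsub_add_cancel_of_le (Finsupp.single_le_iff.2 h)
        rw [smul_eq_mul, mul_left_comm, X, monomial_mul, hb, C_mul_monomial, C_mul_monomial,
          smul_monomial, smul_eq_mul]
        congr 1
        ring
    rw [this, coeff_C_mul, coeff_monomial]
    split_ifs with h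
    · rw [h]
    · simp
  | add p q hp hq => rw [map_add, coeff_add, coeff_add, hp, hq, mul_add]

end DiagonalOperators

/-! ### Poisson torus primes and log-canonical brackets -/

section Bracket

variable {k : Type*} [Field k]

theorem bracketM3_mul_right (f g h : CoordM3 k) :
    bracketM3 k f (g * h) = g * bracketM3 k f h + h * bracketM3 k f g := by
  rw [bracketM3_skew, bracketM3_mul_left, bracketM3_skew h, bracketM3_skew g]
  ring

theorem bracketM3_sub_right (f g h : CoordM3 k) :
    bracketM3 k f (g - h) = bracketM3 k f g - bracketM3 k f h := by
  rw [bracketM3_skew, bracketM3_sub_left, bracketM3_skew h, bracketM3_skew g]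
  ring

theorem bracketM3_X_X (a b : Fin 3 × Fin 3) : bracketM3 k (X a) (X b) = genBracket k a b := by
  unfold bracketM3
  rw [Finset.sum_eq_single a, Finset.sum_eq_single b]
  · simp
  · intro c _ hc
    rw [pderiv_X_of_ne hc.symm]
    simp
  · simp
  · intro c _ hc
    rw [pderiv_X_of_ne hc.symm]
    simp
  · simp

theorem bracketM3_C_left (c : k) (f : CoordM3 k) : bracketM3 k (C c) f = 0 := by
  simp [bracketM3]

theorem bracketM3_transposeM3 (f g : CoordM3 k) :
    bracketM3 k (transposeM3 k f) (transposeM3 k g) = transposeM3 k (bracketM3 k f g) := by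
  have hX : ∀ p, transposeM3 k (X p) = X p.swap := fun p => by simp [transposeM3]
  have hC : ∀ c, transposeM3 k (C c) = C c := fun c => by simp [transposeM3]
  have h1 : ∀ a b : Fin 3 × Fin 3,
      bracketM3 k (X a.swap) (X b.swap) = transposeM3 k (bracketM3 k (X a) (X b)) := by
    rintro ⟨i, j⟩ ⟨l, m⟩
    rw [bracketM3_X_X, bracketM3_X_X, genBracket, genBracket, map_mul, map_mul, map_intCast, hX,
      hX]
    simp only [Prod.swap_prod_mk]
    push_cast
    ring
  have h2 : ∀ (a : Fin 3 × Fin 3) (g : CoordM3 k),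
      bracketM3 k (X a.swap) (transposeM3 k g) = transposeM3 k (bracketM3 k (X a) g) := by
    intro a g
    induction g using MvPolynomial.induction_on with
    | C c => rw [hC, bracketM3_skew, bracketM3_C_left, bracketM3_skew, bracketM3_C_left]; simp
    | add p q hp hq =>
      rw [map_add, bracketM3_skew, bracketM3_add_left, bracketM3_skew _ (X a.swap),
        bracketM3_skew _ (X a.swap), hp, hq, bracketM3_skew _ (p + q), bracketM3_add_left,
        bracketM3_skew p, bracketM3_skew q]
      simp only [map_neg, map_add]
    | mul_X p b hp =>
      rw [map_mul, bracketM3_mul_right, bracketM3_mul_right, hp, hX, h1, map_add, map_mul, map_mul,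
        hX]
  induction f using MvPolynomial.induction_on with
  | C c => rw [hC, bracketM3_C_left, bracketM3_C_left, map_zero]
  | add p q hp hq => rw [map_add, bracketM3_add_left, hp, hq, bracketM3_add_left, map_add]
  | mul_X p b hp =>
    rw [map_mul, bracketM3_mul_left, bracketM3_mul_left, hp, hX, h2, map_add, map_mul, map_mul, hX]

/-- A prime ideal of `O(M₃)` containing `Det - 1` and stable under the Poisson bracket and the
torus of `SL₃`. -/
structure IsPoissonTorusPrime (Q : Ideal (CoordM3 k)) : Prop where
  isPrime : Q.IsPrime
  det_mem : Det3 k - 1 ∈ Q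
  bracket_mem : ∀ f ∈ Q, ∀ g, bracketM3 k f g ∈ Q
  act_mem : ∀ h : torusSL3 k, ∀ f ∈ Q, actM3 k h.1 f ∈ Q

theorem IsPoissonHPrime.isPoissonTorusPrime_comap [IsAlgClosed k] [CharZero k]
    {I : Ideal (CoordSL3 k)} (hI : IsPoissonHPrime I) :
    IsPoissonTorusPrime (I.comap (Ideal.Quotient.mk (detIdeal k))) where
  isPrime := hI.isPrime.comap _
  det_mem := by
    have : Ideal.Quotient.mk (detIdeal k) (Det3 k - 1) = 0 :=
      Ideal.Quotient.eq_zero_iff_mem.2 (Ideal.mem_span_singleton_self _)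
    rw [Ideal.mem_comap, this]
    exact zero_mem _
  bracket_mem f hf g := hI.poisson _ hf (Ideal.Quotient.mk _ g)
  act_mem h f hf := isTorusStable_iff.1 hI.stable h _ hf

/-- Transposition respects the bracket and swaps the two factors of the torus; statements above the
diagonal thus carry over below it. -/
theorem IsPoissonTorusPrime.comap_transposeM3 {Q : Ideal (CoordM3 k)}
    (hQ : IsPoissonTorusPrime Q) : IsPoissonTorusPrime (Q.comap (transposeM3 k)) where
  isPrime := hQ.isPrime.comap _
  det_mem := by
    rw [Ideal.mem_comap, map_sub, transposeM3_det, map_one]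
    exact hQ.det_mem
  bracket_mem f hf g := by
    rw [Ideal.mem_comap, ← bracketM3_transposeM3]
    exact hQ.bracket_mem _ hf _
  act_mem h f hf := by
    have h1 : (transposeM3 k).comp (actM3 k h.1) = (actM3 k h.1.swap).comp (transposeM3 k) := by
      ext1 p
      simp [transposeM3, actM3, mul_comm]
    have h2 : h.1.swap ∈ torusSL3 k := by
      change (∏ i, h.1.2 i) * (∏ j, h.1.1 j) = 1
      rw [mul_comm]
      exact h.2
    have h3 := DFunLike.congr_fun h1 f
    rw [Ideal.mem_comap]
    change (transposeM3 k).comp (actM3 k h.1) f ∈ Q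
    rw [h3]
    exact hQ.act_mem ⟨_, h2⟩ _ hf

end Bracket

section LogCanonical

variable {k : Type*} [Field k] {ι : Type*}

/-- If the `y i` have log-canonical brackets with `w` modulo `Q`, then modulo `Q` the bracket with
`w` acts diagonally on the monomials in the `y i`. -/
theorem bracketM3_aeval_sub_mem {Q : Ideal (CoordM3 k)} (y : ι → CoordM3 k) (w : CoordM3 k)
    (π : ι → k) (h : ∀ i, bracketM3 k (y i) w - C (π i) * y i * w ∈ Q) (p : MvPolynomial ι k) :
    bracketM3 k (aeval y p) w - w * aeval y (mkDerivation k (fun i => C (π i) * X i) p) ∈ Q := by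
  induction p using MvPolynomial.induction_on with
  | C c =>
    rw [aeval_C, algebraMap_eq, bracketM3_C_left, ← algebraMap_eq, Derivation.map_algebraMap]
    simp
  | add p q hp hq =>
    rw [map_add, map_add, bracketM3_add_left, map_add]
    convert add_mem hp hq using 1
    ring
  | mul_X p i hp =>
    rw [map_mul, bracketM3_mul_left, Derivation.leibniz, mkDerivation_X, map_add, smul_eq_mul,
      smul_eq_mul, map_mul, map_mul, map_mul, aeval_X, aeval_C, algebraMap_eq]
    convert add_mem (Q.mul_mem_left (aeval y p) (h i)) (Q.mul_mem_left (y i) hp) using 1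
    ring

/-- Modulo `Q` the bracket with `w` is `w` times a diagonal derivation, and the factor `w ∉ Q`
cancels. -/
theorem IsPoissonTorusPrime.exists_mem_of_logCanonical [Fintype ι] {Q : Ideal (CoordM3 k)}
    (hQ : IsPoissonTorusPrime Q) (y : ι → CoordM3 k) {w : CoordM3 k} (hw : w ∉ Q)
    (π : ι → k) (h : ∀ i, bracketM3 k (y i) w - C (π i) * y i * w ∈ Q) (p : MvPolynomial ι k)
    (hp : aeval y p ∈ Q) :
    ∃ q, aeval y q ∈ Q ∧ ∀ a, coeff a q = (∑ i, π i * a i) * coeff a p := by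
  refine ⟨_, (hQ.isPrime.mem_or_mem ?_).resolve_left hw, coeff_mkDerivation_C_mul_X π p⟩
  have h1 := sub_mem (hQ.bracket_mem _ hp w) (bracketM3_aeval_sub_mem y w π h p)
  rwa [sub_sub_cancel] at h1

theorem IsPoissonTorusPrime.exists_mem_of_weight [Fintype ι] {Q : Ideal (CoordM3 k)}
    (hQ : IsPoissonTorusPrime Q) (y : ι → CoordM3 k) (t : torusSL3 k)
    (χ : ι → k) (h : ∀ i, actM3 k t.1 (y i) = C (χ i) * y i) (p : MvPolynomial ι k)
    (hp : aeval y p ∈ Q) :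
    ∃ q, aeval y q ∈ Q ∧ ∀ a, coeff a q = (∏ i, χ i ^ a i) * coeff a p := by
  refine ⟨_, ?_, coeff_aeval_C_mul_X χ p⟩
  have h1 : (aeval y).comp (aeval fun i => C (χ i) * X i) = (actM3 k t.1).comp (aeval y) := by
    ext1 i
    simp [h]
  have h2 := DFunLike.congr_fun h1 p
  simp only [AlgHom.comp_apply] at h2
  rw [h2]
  exact hQ.act_mem t _ hp

end LogCanonical

/-! ### Vanishing patterns of Poisson torus primes -/

section Strata

variable {k : Type*} [Field k]

/-- The minor on rows 1, 2 and columns 1, 2. -/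
noncomputable def leadingMinor (k : Type*) [Field k] : CoordM3 k :=
  X (0, 0) * X (1, 1) - X (0, 1) * X (1, 0)

/-- The elements from which the coordinates on the cells are chosen. -/
noncomputable def clusterVar (k : Type*) [Field k] : Fin 10 → CoordM3 k :=
  ![X (0, 0), leadingMinor k, X (0, 1), X (0, 2), upperMinor k, X (1, 2),
    X (1, 0), X (2, 0), lowerMinor k, X (2, 1)]

namespace CellType

/-- The indices of the elements `clusterVar` above the diagonal used on a cell. -/
def upperIdx : CellType → Finset (Fin 10)
  | generic => {2, 3, 4}
  | corner => {2, 5}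
  | minor => {2, 3}
  | row => {5}
  | column => {2}
  | triangular => ∅

/-- The indices of the elements `clusterVar` below the diagonal used on a cell. -/
def lowerIdx : CellType → Finset (Fin 10)
  | generic => {6, 7, 8}
  | corner => {6, 9}
  | minor => {6, 7}
  | row => {9}
  | column => {6}
  | triangular => ∅

/-- The indices of the elements `clusterVar` used on a cell. -/
def clusterIdx (u v : CellType) : Finset (Fin 10) := {0, 1} ∪ (u.upperIdx ∪ v.lowerIdx)

end CellType

theorem int_sign_two : Int.sign 2 = 1 := rfl

theorem transposeM3_upperMinor : transposeM3 k (upperMinor k) = lowerMinor k := by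
  simp [transposeM3, upperMinor, lowerMinor]
  ring

theorem bracketM3_X_01_12 :
    bracketM3 k (X (0, 1)) (X (1, 2)) = 2 * (X (0, 2) * X (1, 1)) := by
  simp [bracketM3_X_X, genBracket, one_add_one_eq_two]

theorem bracketM3_X_01_22 :
    bracketM3 k (X (0, 1)) (X (2, 2)) = 2 * (X (0, 2) * X (2, 1)) := by
  simp [bracketM3_X_X, genBracket, int_sign_two, one_add_one_eq_two]

theorem bracketM3_X_00 (i j : Fin 3) (hi : i ≠ 0) (hj : j ≠ 0) :
    bracketM3 k (X (0, 0)) (X (i, j)) = 2 * (X (0, j) * X (i, 0)) := by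
  fin_cases i <;> fin_cases j <;> 
    simp [bracketM3_X_X, genBracket, int_sign_two, one_add_one_eq_two] at hi hj ⊢

theorem bracketM3_leadingMinor_X_22 : bracketM3 k (leadingMinor k) (X (2, 2)) =
    2 * (X (2, 2) * leadingMinor k - Det3 k) := by
  simp [leadingMinor, bracketM3_sub_left, bracketM3_mul_left, bracketM3_X_X, genBracket,
    int_sign_two, det3_eq]
  ring

variable {Q : Ideal (CoordM3 k)}

theorem IsPoissonTorusPrime.det_notMem (hQ : IsPoissonTorusPrime Q) : Det3 k ∉ Q := fun h =>
  hQ.isPrime.ne_top (Q.eq_top_iff_one.2 (by simpa using sub_mem h hQ.det_mem))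

theorem IsPoissonTorusPrime.mem_of_two_mul_mem [CharZero k] (_ : IsPoissonTorusPrime Q)
    {x : CoordM3 k} (h : 2 * x ∈ Q) : x ∈ Q := by
  have : IsUnit (2 : CoordM3 k) := by
    have := (IsUnit.mk0 (2 : k) two_ne_zero).map (C (σ := Fin 3 × Fin 3))
    rwa [map_ofNat] at this
  exact (Q.unit_mul_mem_iff_mem this).1 h

/-- If `x₁₁ ∈ Q`, the brackets `{x₁₁, xᵢⱼ} = 2 x₁ⱼ xᵢ₁` put the whole first row or the whole first
column in `Q`, hence also `Det`. -/
theorem IsPoissonTorusPrime.X_00_notMem [CharZero k] (hQ : IsPoissonTorusPrime Q) :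
    X (0, 0) ∉ Q := by
  intro h
  have hprime := hQ.isPrime
  have key : ∀ i j, i ≠ 0 → j ≠ 0 → X (0, j) ∈ Q ∨ X (i, 0) ∈ Q := fun i j hi hj =>
    hprime.mem_or_mem (hQ.mem_of_two_mul_mem (bracketM3_X_00 (k := k) i j hi hj ▸
      hQ.bracket_mem _ h _))
  apply hQ.det_notMem
  rw [det3_eq]
  have h' : (X (0, 1) ∈ Q ∧ X (0, 2) ∈ Q) ∨ (X (1, 0) ∈ Q ∧ X (2, 0) ∈ Q) := by
    have h1 := key 1 1 (by decide) (by decide)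
    have h2 := key 1 2 (by decide) (by decide)
    have h3 := key 2 1 (by decide) (by decide)
    have h4 := key 2 2 (by decide) (by decide)
    tauto
  rw [← Ideal.Quotient.eq_zero_iff_mem] at h ⊢
  simp only [← Ideal.Quotient.eq_zero_iff_mem] at h'
  simp only [map_sub, map_add, map_mul, h]
  rcases h' with ⟨h1, h2⟩ | ⟨h1, h2⟩ <;> simp [h1, h2]

theorem IsPoissonTorusPrime.leadingMinor_notMem [CharZero k] (hQ : IsPoissonTorusPrime Q) :
    leadingMinor k ∉ Q := by
  intro h
  have h1 := hQ.mem_of_two_mul_mem (bracketM3_leadingMinor_X_22 (k := k) ▸ hQ.bracket_mem _ h _)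
  exact hQ.det_notMem (by simpa using sub_mem (Q.mul_mem_left (X (2, 2)) h) h1)

/-- Bracketing `x₁₂` with `x₂₃` and `x₃₃` would put the whole second column in `Q`, hence also
`Det`. -/
theorem IsPoissonTorusPrime.X_01_notMem [CharZero k] (hQ : IsPoissonTorusPrime Q)
    (h13 : X (0, 2) ∉ Q) : X (0, 1) ∉ Q := by
  intro h
  have h1 := (hQ.isPrime.mem_or_mem (hQ.mem_of_two_mul_mem
    (bracketM3_X_01_12 (k := k) ▸ hQ.bracket_mem _ h _))).resolve_left h13
  have h2 := (hQ.isPrime.mem_or_mem (hQ.mem_of_two_mul_mem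
    (bracketM3_X_01_22 (k := k) ▸ hQ.bracket_mem _ h _))).resolve_left h13
  apply hQ.det_notMem
  rw [det3_eq]
  rw [← Ideal.Quotient.eq_zero_iff_mem] at h h1 h2 ⊢
  simp [h, h1, h2]

/-- Whether `x₁₃` and the upper minor lie in `Q` decides the pattern, except when both do; then `x₁₂
x₂₃ ∈ Q` and primality leaves three cases. -/
theorem IsPoissonTorusPrime.exists_upperGens_subset [CharZero k] (hQ : IsPoissonTorusPrime Q) :
    ∃ u : CellType, u.upperGens k ⊆ Q ∧ ∀ i ∈ u.upperIdx, clusterVar k i ∉ Q := by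
  by_cases h13 : X (0, 2) ∈ Q
  · by_cases hm : upperMinor k ∈ Q
    · have h : X (0, 1) * X (1, 2) ∈ Q := by
        have := add_mem hm (Q.mul_mem_right (X (1, 1)) h13)
        rwa [upperMinor, sub_add_cancel] at this
      by_cases h12 : X (0, 1) ∈ Q <;> by_cases h23 : X (1, 2) ∈ Q
      · exact ⟨triangular, by simp [upperGens, Set.insert_subset_iff, h12, h13, h23],
          by simp [upperIdx]⟩
      · exact ⟨row, by simp [upperGens, Set.insert_subset_iff, h12, h13],
          by simp [upperIdx, clusterVar, h23]⟩
      · exact ⟨column, by simp [upperGens, Set.insert_subset_iff, h23, h13],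
          by simp [upperIdx, clusterVar, h12]⟩
      · exact ((hQ.isPrime.mem_or_mem h).elim h12 h23).elim
    · have h : X (0, 1) * X (1, 2) ∉ Q := fun h =>
        hm (sub_mem h (Q.mul_mem_right (X (1, 1)) h13))
      exact ⟨corner, by simp [upperGens, h13], by
        simpa [upperIdx, clusterVar] using
          ⟨fun h1 => h (Q.mul_mem_right _ h1), fun h1 => h (Q.mul_mem_left _ h1)⟩⟩
  · have h12 := hQ.X_01_notMem h13
    by_cases hm : upperMinor k ∈ Q
    · exact ⟨minor, by simp [upperGens, hm], by simp [upperIdx, clusterVar, h12, h13]⟩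
    · exact ⟨generic, by simp [upperGens], by simp [upperIdx, clusterVar, h12, h13, hm]⟩

theorem IsPoissonTorusPrime.exists_cellIdeal_le [CharZero k] (hQ : IsPoissonTorusPrime Q) :
    ∃ u v, cellIdeal k u v ≤ Q ∧ ∀ i ∈ clusterIdx u v, clusterVar k i ∉ Q := by
  obtain ⟨u, hu, hu'⟩ := hQ.exists_upperGens_subset
  obtain ⟨v, hv, hv'⟩ := hQ.comap_transposeM3.exists_upperGens_subset
  refine ⟨u, v, ?_, fun i hi => ?_⟩
  · rw [cellIdeal, Ideal.span_le, Set.insert_subset_iff, Set.union_subset_iff,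
      Set.image_subset_iff]
    exact ⟨hQ.det_mem, hu, hv⟩
  · have hlower : ∀ i ∈ v.lowerIdx, ∃ j ∈ v.upperIdx,
        clusterVar k i = transposeM3 k (clusterVar k j) := by
      cases v <;> simp [lowerIdx, upperIdx, clusterVar, transposeM3_upperMinor] <;>
        simp [transposeM3]
    simp only [clusterIdx, Finset.mem_union, Finset.mem_insert, Finset.mem_singleton] at hi
    rcases hi with (rfl | rfl) | hi | hi
    · exact hQ.X_00_notMem
    · exact hQ.leadingMinor_notMem
    · exact hu' i hi
    · obtain ⟨j, hj, h⟩ := hlower i hi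
      rw [h]
      exact hv' j hj

end Strata

/-! ### Log-canonical coordinates on the cells -/

section Coordinates

variable {k : Type*} [Field k]

/-- The coefficients of the log-canonical brackets `{clusterVar i, x₁₁}`. -/
def logCoeff₁ : Fin 10 → ℤ := ![0, 0, -1, -1, -1, 0, -1, -1, -1, 0]

/-- The coefficients of the log-canonical brackets of `clusterVar i` with the leading minor. -/
def logCoeff₂ : Fin 10 → ℤ := ![0, 0, 0, -1, -1, -1, 0, -1, -1, -1]

/-- The coefficients of the log-canonical brackets `{clusterVar i, x₁₂}`. -/
def logCoeff₃ : Fin 10 → ℤ := ![1, 0, 0, -1, 0, 0, 0, 0, -1, -1]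

/-- The coefficients of the log-canonical brackets `{clusterVar i, x₂₁}`. -/
def logCoeff₄ : Fin 10 → ℤ := ![1, 0, 0, 0, -1, -1, 0, -1, 0, 0]

/-- The bracket is exactly log-canonical except for `x₂₃` and `x₃₂`. Their error terms are multiples
of `x₁₃` and `x₃₁`, which vanish on the cells where these coordinates are used. -/
theorem bracketM3_clusterVar_X_00 {Q : Ideal (CoordM3 k)} (i : Fin 10)
    (h5 : i = 5 → X (0, 2) ∈ Q) (h9 : i = 9 → X (2, 0) ∈ Q) :
    bracketM3 k (clusterVar k i) (X (0, 0)) - C (logCoeff₁ i : k) * clusterVar k i * X (0, 0)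
      ∈ Q := by
  have key : i ≠ 5 → i ≠ 9 → bracketM3 k (clusterVar k i) (X (0, 0)) -
      C (logCoeff₁ i : k) * clusterVar k i * X (0, 0) = 0 := by
    intro h5 h9
    fin_cases i <;> first
      | exact absurd rfl h5
      | exact absurd rfl h9
      | simp [clusterVar, logCoeff₁, leadingMinor, upperMinor, lowerMinor, bracketM3_sub_left,
          bracketM3_mul_left, bracketM3_X_X, genBracket, int_sign_two] <;> ring
  by_cases hi5 : i = 5
  · subst hi5
    have : bracketM3 k (clusterVar k 5) (X (0, 0)) - C (logCoeff₁ 5 : k) * clusterVar k 5 *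
        X (0, 0) = (-2 * X (1, 0)) * X (0, 2) := by
      simp [clusterVar, logCoeff₁, bracketM3_X_X, genBracket, int_sign_two]
      ring
    exact this ▸ Q.mul_mem_left _ (h5 rfl)
  by_cases hi9 : i = 9
  · subst hi9
    have : bracketM3 k (clusterVar k 9) (X (0, 0)) - C (logCoeff₁ 9 : k) * clusterVar k 9 *
        X (0, 0) = (-2 * X (0, 1)) * X (2, 0) := by
      simp [clusterVar, logCoeff₁, bracketM3_X_X, genBracket, int_sign_two]
      ring
    exact this ▸ Q.mul_mem_left _ (h9 rfl)
  exact key hi5 hi9 ▸ zero_mem _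

theorem bracketM3_clusterVar_leadingMinor (i : Fin 10) :
    bracketM3 k (clusterVar k i) (leadingMinor k) -
      C (logCoeff₂ i : k) * clusterVar k i * leadingMinor k = 0 := by
  fin_cases i <;>
    simp [clusterVar, logCoeff₂, leadingMinor, upperMinor, lowerMinor, bracketM3_sub_left,
      bracketM3_mul_left, bracketM3_sub_right, bracketM3_mul_right, bracketM3_X_X, genBracket,
      int_sign_two] <;>
    ring

theorem bracketM3_clusterVar_X_01 {Q : Ideal (CoordM3 k)} (i : Fin 10)
    (h5 : i = 5 → X (0, 2) ∈ Q) :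
    bracketM3 k (clusterVar k i) (X (0, 1)) - C (logCoeff₃ i : k) * clusterVar k i * X (0, 1)
      ∈ Q := by
  have key : i ≠ 5 → bracketM3 k (clusterVar k i) (X (0, 1)) -
      C (logCoeff₃ i : k) * clusterVar k i * X (0, 1) = 0 := by
    intro h5
    fin_cases i <;> first
      | exact absurd rfl h5
      | simp [clusterVar, logCoeff₃, leadingMinor, upperMinor, lowerMinor, bracketM3_sub_left,
          bracketM3_mul_left, bracketM3_X_X, genBracket, int_sign_two] <;> ring
  by_cases hi5 : i = 5
  · subst hi5
    have : bracketM3 k (clusterVar k 5) (X (0, 1)) - C (logCoeff₃ 5 : k) * clusterVar k 5 *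
        X (0, 1) = (-2 * X (1, 1)) * X (0, 2) := by
      simp [clusterVar, logCoeff₃, bracketM3_X_X, genBracket]
      ring
    exact this ▸ Q.mul_mem_left _ (h5 rfl)
  exact key hi5 ▸ zero_mem _

theorem bracketM3_clusterVar_X_10 {Q : Ideal (CoordM3 k)} (i : Fin 10)
    (h9 : i = 9 → X (2, 0) ∈ Q) :
    bracketM3 k (clusterVar k i) (X (1, 0)) - C (logCoeff₄ i : k) * clusterVar k i * X (1, 0)
      ∈ Q := by
  have key : i ≠ 9 → bracketM3 k (clusterVar k i) (X (1, 0)) -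
      C (logCoeff₄ i : k) * clusterVar k i * X (1, 0) = 0 := by
    intro h9
    fin_cases i <;> first
      | exact absurd rfl h9
      | simp [clusterVar, logCoeff₄, leadingMinor, upperMinor, lowerMinor, bracketM3_sub_left,
          bracketM3_mul_left, bracketM3_X_X, genBracket, int_sign_two] <;> ring
  by_cases hi9 : i = 9
  · subst hi9
    have : bracketM3 k (clusterVar k 9) (X (1, 0)) - C (logCoeff₄ 9 : k) * clusterVar k 9 *
        X (1, 0) = (-2 * X (1, 1)) * X (2, 0) := by
      simp [clusterVar, logCoeff₄, bracketM3_X_X, genBracket]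
      ring
    exact this ▸ Q.mul_mem_left _ (h9 rfl)
  exact key hi9 ▸ zero_mem _

/-- The weights of the elements `clusterVar` under the one-parameter group of weights `s, t`. -/
def clusterWeight (s t : Fin 3 → ℤ) : Fin 10 → ℤ :=
  ![s 0 + t 0, s 0 + t 0 + (s 1 + t 1), s 0 + t 1, s 0 + t 2, s 0 + t 1 + (s 1 + t 2), s 1 + t 2,
    s 1 + t 0, s 2 + t 0, s 1 + t 0 + (s 2 + t 1), s 2 + t 1]

/-- The element `(2 ^ s, 2 ^ t)` of the torus. -/
noncomputable def torusPow (k : Type*) [Field k] [CharZero k] (s t : Fin 3 → ℤ)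
    (h : ∑ i, s i + ∑ j, t j = 0) : torusSL3 k :=
  ⟨(fun i => Units.mk0 2 two_ne_zero ^ s i, fun j => Units.mk0 2 two_ne_zero ^ t j), by
    change (∏ i, _ ^ s i) * (∏ j, _ ^ t j) = 1
    simp only [Fin.prod_univ_three, Fin.sum_univ_three, ← zpow_add] at h ⊢
    rw [h, zpow_zero]⟩

theorem actM3_clusterVar [CharZero k] (s t : Fin 3 → ℤ) (h : ∑ i, s i + ∑ j, t j = 0)
    (i : Fin 10) : actM3 k (torusPow k s t h).1 (clusterVar k i) =
      C ((2 : k) ^ clusterWeight s t i) * clusterVar k i := by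
  have h2 : (2 : k) ≠ 0 := two_ne_zero
  fin_cases i <;>
    simp [clusterVar, clusterWeight, actM3, torusPow, leadingMinor, upperMinor, lowerMinor,
      zpow_add₀ h2] <;>
    ring

theorem mem_clusterIdx_iff_upper (u v : CellType) :
    ∀ i ∈ ({2, 3, 4, 5} : Finset (Fin 10)), i ∈ clusterIdx u v ↔ i ∈ u.upperIdx := by
  cases v <;> cases u <;> decide

theorem mem_clusterIdx_iff_lower (u v : CellType) :
    ∀ i ∈ ({6, 7, 8, 9} : Finset (Fin 10)), i ∈ clusterIdx u v ↔ i ∈ v.lowerIdx := by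
  cases v <;> cases u <;> decide

set_option maxHeartbeats 800000 in
/-- The exponents of a monomial in the coordinates on a cell are determined by its weights and by
its brackets with `x₁₁`, the leading minor, `x₁₂` and `x₂₁`. -/
theorem eq_zero_of_logCoeff_of_weight (u v : CellType) (c : Fin 10 → ℤ)
    (hc : ∀ i, i ∉ clusterIdx u v → c i = 0)
    (hw : ∀ s t : Fin 3 → ℤ, ∑ i, s i + ∑ j, t j = 0 → ∑ i, clusterWeight s t i * c i = 0)
    (h₁ : ∑ i, logCoeff₁ i * c i = 0) (h₂ : ∑ i, logCoeff₂ i * c i = 0)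
    (h₃ : 2 ∈ clusterIdx u v → ∑ i, logCoeff₃ i * c i = 0)
    (h₄ : 6 ∈ clusterIdx u v → ∑ i, logCoeff₄ i * c i = 0) : c = 0 := by
  -- These five cocharacters form a basis of the rank-five lattice of one-parameter subgroups.
  have w1 := hw ![1, -1, 0] 0 (by simp [Fin.sum_univ_three])
  have w2 := hw ![0, 1, -1] 0 (by simp [Fin.sum_univ_three])
  have w3 := hw 0 ![1, -1, 0] (by simp [Fin.sum_univ_three])
  have w4 := hw 0 ![0, 1, -1] (by simp [Fin.sum_univ_three])
  have w5 := hw ![1, 0, 0] ![-1, 0, 0] (by simp [Fin.sum_univ_three])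
  clear hw
  have hsum : ∀ f : Fin 10 → ℤ,
      ∑ i, f i = f 0 + f 1 + f 2 + f 3 + f 4 + f 5 + f 6 + f 7 + f 8 + f 9 := fun f => by
    simp [Fin.sum_univ_succ]
    ring
  simp only [hsum, clusterWeight, logCoeff₁, logCoeff₂, logCoeff₃, logCoeff₄, Matrix.cons_val,
    Pi.zero_apply] at w1 w2 w3 w4 w5 h₁ h₂ h₃ h₄
  have h2 := hc 2
  have h3 := hc 3
  have h4 := hc 4
  have h5 := hc 5
  have h6 := hc 6
  have h7 := hc 7
  have h8 := hc 8
  have h9 := hc 9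
  rw [mem_clusterIdx_iff_upper _ _ _ (by decide)] at h2 h3 h4 h5 h₃
  rw [mem_clusterIdx_iff_lower _ _ _ (by decide)] at h6 h7 h8 h9 h₄
  clear hc
  suffices c 0 = 0 ∧ c 1 = 0 ∧ c 2 = 0 ∧ c 3 = 0 ∧ c 4 = 0 ∧ c 5 = 0 ∧ c 6 = 0 ∧ c 7 = 0 ∧
      c 8 = 0 ∧ c 9 = 0 by
    funext i
    fin_cases i <;> simp [this]
  generalize c 0 = c0, c 1 = c1, c 2 = c2, c 3 = c3, c 4 = c4, c 5 = c5, c 6 = c6, c 7 = c7,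
    c 8 = c8, c 9 = c9 at *
  clear c
  cases u <;> simp [upperIdx] at h2 h3 h4 h5 h₃ <;> cases v <;>
    simp [lowerIdx] at h6 h7 h8 h9 h₄ <;> grind

end Coordinates

section Coordinates

variable {k : Type*} [Field k]

theorem X_02_mem_cellIdeal {u v : CellType} (h : 5 ∈ clusterIdx u v) :
    X (0, 2) ∈ cellIdeal k u v := by
  rw [mem_clusterIdx_iff_upper _ _ _ (by decide)] at h
  refine upperGens_subset_cellIdeal _ _ ?_
  cases u <;> simp [upperIdx, upperGens] at h ⊢

theorem X_20_mem_cellIdeal {u v : CellType} (h : 9 ∈ clusterIdx u v) :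
    X (2, 0) ∈ cellIdeal k u v := by
  rw [mem_clusterIdx_iff_lower _ _ _ (by decide)] at h
  have : X (0, 2) ∈ v.upperGens k := by
    cases v <;> simp [lowerIdx, upperGens] at h ⊢
  simpa [transposeM3] using lowerGens_subset_cellIdeal u v this

theorem prod_two_zpow [CharZero k] {ι : Type*} (s : Finset ι) (f : ι → ℤ) :
    ∏ i ∈ s, (2 : k) ^ f i = 2 ^ ∑ i ∈ s, f i := by
  classical
  induction s using Finset.induction_on with
  | empty => simp
  | insert i s hi ih =>
    rw [Finset.prod_insert hi, Finset.sum_insert hi, ih, zpow_add₀ two_ne_zero]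

/-- Distinct integral weights thus give distinct eigenvalues for torus elements whose coordinates
are powers of 2. -/
theorem two_zpow_injective [CharZero k] : Function.Injective fun n : ℤ => (2 : k) ^ n := by
  intro m n h
  have : (2 : ℚ) ^ m = 2 ^ n := by
    apply Rat.cast_injective (α := k)
    simpa using h
  exact zpow_right_injective₀ two_pos (by norm_num) this

/-- The elements `clusterVar` used on a cell are algebraically independent modulo a Poisson
torus prime that contains the ideal of the cell and none of them. -/
theorem IsPoissonTorusPrime.eq_zero_of_aeval_clusterVar_mem [CharZero k] {Q : Ideal (CoordM3 k)}
    (hQ : IsPoissonTorusPrime Q) {u v : CellType} (hle : cellIdeal k u v ≤ Q)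
    (hne : ∀ i ∈ clusterIdx u v, clusterVar k i ∉ Q) (p : MvPolynomial (clusterIdx u v) k)
    (hp : aeval (fun i : clusterIdx u v => clusterVar k i) p ∈ Q) : p = 0 := by
  set y : clusterIdx u v → CoordM3 k := fun i => clusterVar k i
  have h0 : (0 : Fin 10) ∈ clusterIdx u v := by simp [clusterIdx]
  have h1 : (1 : Fin 10) ∈ clusterIdx u v := by simp [clusterIdx]
  have hQ5 : ∀ i : clusterIdx u v, (i : Fin 10) = 5 → X (0, 2) ∈ Q := fun i hi =>
    hle (X_02_mem_cellIdeal (hi ▸ i.2))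
  have hQ9 : ∀ i : clusterIdx u v, (i : Fin 10) = 9 → X (2, 0) ∈ Q := fun i hi =>
    hle (X_20_mem_cellIdeal (hi ▸ i.2))
  -- `K` collects the relations among the cluster elements modulo `Q`, and `S` the eigenvalue
  -- functions of the diagonal operators preserving it.
  let K : Ideal (MvPolynomial (clusterIdx u v) k) := Q.comap (aeval y)
  let S : Set ((clusterIdx u v →₀ ℕ) → k) :=
    {g | ∀ p ∈ K, ∃ q ∈ K, ∀ a, coeff a q = g a * coeff a p}
  have hlog : ∀ (l : Fin 10 → ℤ) (w : CoordM3 k), w ∉ Q → (∀ i : clusterIdx u v,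
      bracketM3 k (clusterVar k i) w - C (l i : k) * clusterVar k i * w ∈ Q) →
      (fun a => ∑ i : clusterIdx u v, (l i : k) * a i) ∈ S := fun l w hw h p hp =>
    hQ.exists_mem_of_logCanonical y hw (fun i => (l i : k)) h p hp
  refine eq_zero_of_diagonal_operators K (hQ.isPrime.comap _)
    (fun i hi => hne i i.2 (by simpa [K, y] using hi)) (fun g : S => g.1)
    (fun g => g.2) (fun a b hab => ?_) p hp
  have hab' : ∀ g ∈ S, g a = g b := fun g hg => hab ⟨g, hg⟩
  classical
  -- The difference of two exponents with equal eigenvalues, extended by zero to all ten indices so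
  -- that one linear system covers every cell.
  let c : Fin 10 → ℤ := fun i =>
    if h : i ∈ clusterIdx u v then (a ⟨i, h⟩ : ℤ) - b ⟨i, h⟩ else 0
  have hc : ∀ l : Fin 10 → ℤ, ∑ i : clusterIdx u v, l i * (a i : ℤ) =
      ∑ i : clusterIdx u v, l i * (b i : ℤ) → ∑ i, l i * c i = 0 := by
    intro l h
    rw [← sub_eq_zero, ← Finset.sum_sub_distrib] at h
    rw [← h, ← Finset.sum_subset (Finset.subset_univ (clusterIdx u v))
      (fun i _ hi => by simp [c, hi]), ← Finset.sum_coe_sort]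
    refine Finset.sum_congr rfl fun i _ => ?_
    simp [c, mul_sub]
  have hclog : ∀ (l : Fin 10 → ℤ) (w : CoordM3 k), w ∉ Q → (∀ i : clusterIdx u v,
      bracketM3 k (clusterVar k i) w - C (l i : k) * clusterVar k i * w ∈ Q) →
      ∑ i, l i * c i = 0 := by
    intro l w hw h
    have := hab' _ (hlog l w hw h)
    exact hc l (by exact_mod_cast this)
  have hczero : c = 0 := by
    refine eq_zero_of_logCoeff_of_weight u v c (fun i hi => by simp [c, hi]) ?_ ?_ ?_ ?_ ?_
    · intro s t hst
      refine hc _ ?_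
      have := hab' _ (fun p hp => hQ.exists_mem_of_weight y (torusPow k s t hst)
        (fun i => 2 ^ clusterWeight s t i) (fun i => actM3_clusterVar s t hst i) p hp)
      simp only [← zpow_natCast, ← zpow_mul] at this
      rw [prod_two_zpow, prod_two_zpow] at this
      exact two_zpow_injective this
    · exact hclog _ _ (hne 0 h0) fun i => bracketM3_clusterVar_X_00 i (hQ5 i) (hQ9 i)
    · exact hclog _ _ (hne 1 h1) fun i => bracketM3_clusterVar_leadingMinor (k := k) i ▸ zero_mem _
    · exact fun h => hclog _ _ (hne 2 h) fun i => bracketM3_clusterVar_X_01 i (hQ5 i)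
    · exact fun h => hclog _ _ (hne 6 h) fun i => bracketM3_clusterVar_X_10 i (hQ9 i)
  ext i
  have := congrFun hczero i
  simp only [c, i.2, dite_true, Subtype.coe_eta, Pi.zero_apply] at this
  omega

/-- The missing entries are solved in order: `x₂₂` from the leading minor, `x₂₃` and `x₃₂` from the
upper and lower minors where they are not themselves coordinates or zero, and `x₃₃` from `Det = 1`,
where its coefficient is the leading minor. -/
theorem mem_saturation_clusterVar {u v : CellType}
    (hM : Submonoid.closure (Set.range fun i : clusterIdx u v =>
      Ideal.Quotient.mkₐ k (cellIdeal k u v) (clusterVar k i)) ≤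
      ((Ideal.Quotient.mkₐ k (cellIdeal k u v)).comp
        (aeval fun i : clusterIdx u v => clusterVar k i)).range.toSubmonoid) (f : CoordM3 k) :
    Ideal.Quotient.mkₐ k (cellIdeal k u v) f ∈
      ((Ideal.Quotient.mkₐ k (cellIdeal k u v)).comp
        (aeval fun i : clusterIdx u v => clusterVar k i)).range.saturation _ hM := by
  set mk := Ideal.Quotient.mkₐ k (cellIdeal k u v)
  set T := (mk.comp (aeval fun i : clusterIdx u v => clusterVar k i)).range.saturation _ hM
  have hcl : ∀ i ∈ clusterIdx u v, mk (clusterVar k i) ∈ T := fun i hi =>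
    Subalgebra.le_saturation ⟨X ⟨i, hi⟩, by simp⟩
  have hdiv : ∀ i ∈ clusterIdx u v, ∀ f, mk (clusterVar k i) * mk f ∈ T → mk f ∈ T :=
    fun i hi f h => Subalgebra.mem_saturation_of_mul_mem_left h
      (Submonoid.subset_closure ⟨⟨i, hi⟩, rfl⟩)
  have hzero : ∀ f ∈ cellIdeal k u v, mk f ∈ T := fun f hf => by
    rw [show mk f = 0 from Ideal.Quotient.eq_zero_iff_mem.2 hf]
    exact zero_mem _
  have hup : ∀ f ∈ u.upperGens k, mk f ∈ T := fun f hf => hzero f (upperGens_subset_cellIdeal u v hf)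
  have hlow : ∀ f ∈ v.upperGens k, mk (transposeM3 k f) ∈ T := fun f hf =>
    hzero _ (lowerGens_subset_cellIdeal u v hf)
  have hidx := mem_clusterIdx_iff_upper u v
  have hidx' := mem_clusterIdx_iff_lower u v
  have h00 : mk (X (0, 0)) ∈ T := hcl 0 (by simp [clusterIdx])
  have hlead : mk (leadingMinor k) ∈ T := hcl 1 (by simp [clusterIdx])
  have h01 : mk (X (0, 1)) ∈ T := by
    by_cases h : 2 ∈ clusterIdx u v
    · exact hcl 2 h
    · rw [hidx _ (by decide)] at h
      exact hup _ (by cases u <;> simp [upperIdx, upperGens] at h ⊢)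
  have h02 : mk (X (0, 2)) ∈ T := by
    by_cases h : 3 ∈ clusterIdx u v
    · exact hcl 3 h
    · rw [hidx _ (by decide)] at h
      exact hup _ (by cases u <;> simp [upperIdx, upperGens] at h ⊢)
  have h10 : mk (X (1, 0)) ∈ T := by
    by_cases h : 6 ∈ clusterIdx u v
    · exact hcl 6 h
    · rw [hidx' _ (by decide)] at h
      have := hlow (X (0, 1)) (by cases v <;> simp [lowerIdx, upperGens] at h ⊢)
      simpa [transposeM3] using this
  have h20 : mk (X (2, 0)) ∈ T := by
    by_cases h : 7 ∈ clusterIdx u v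
    · exact hcl 7 h
    · rw [hidx' _ (by decide)] at h
      have := hlow (X (0, 2)) (by cases v <;> simp [lowerIdx, upperGens] at h ⊢)
      simpa [transposeM3] using this
  have h11 : mk (X (1, 1)) ∈ T := by
    refine hdiv 0 (by simp [clusterIdx]) _ ?_
    have : mk (clusterVar k 0) * mk (X (1, 1)) =
        mk (leadingMinor k) + mk (X (0, 1)) * mk (X (1, 0)) := by
      simp [clusterVar, leadingMinor]
    rw [this]
    exact add_mem hlead (mul_mem h01 h10)
  have h12 : mk (X (1, 2)) ∈ T := by
    have key : 2 ∈ clusterIdx u v → mk (upperMinor k) ∈ T → mk (X (1, 2)) ∈ T := by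
      intro h hm
      refine hdiv 2 h _ ?_
      have : mk (clusterVar k 2) * mk (X (1, 2)) =
          mk (upperMinor k) + mk (X (0, 2)) * mk (X (1, 1)) := by
        simp [clusterVar, upperMinor]
      rw [this]
      exact add_mem hm (mul_mem h02 h11)
    have h4 : 4 ∈ clusterIdx u v → mk (upperMinor k) ∈ T := hcl 4
    have h5 : 5 ∈ clusterIdx u v → mk (X (1, 2)) ∈ T := hcl 5
    rw [hidx _ (by decide)] at key h4 h5
    cases u <;> simp [upperIdx, upperGens] at key h4 h5 hup
    · exact key h4
    · exact h5
    · exact key hup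
    · exact h5
    · simp_all
    · simp_all
  have h21 : mk (X (2, 1)) ∈ T := by
    have key : 6 ∈ clusterIdx u v → mk (lowerMinor k) ∈ T → mk (X (2, 1)) ∈ T := by
      intro h hm
      refine hdiv 6 h _ ?_
      have : mk (clusterVar k 6) * mk (X (2, 1)) =
          mk (lowerMinor k) + mk (X (2, 0)) * mk (X (1, 1)) := by
        simp [clusterVar, lowerMinor, mul_comm]
      rw [this]
      exact add_mem hm (mul_mem h20 h11)
    have h8 : 8 ∈ clusterIdx u v → mk (lowerMinor k) ∈ T := hcl 8
    have h9 : 9 ∈ clusterIdx u v → mk (X (2, 1)) ∈ T := hcl 9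
    rw [hidx' _ (by decide)] at key h8 h9
    have hX : transposeM3 k (X (1, 2)) = X (2, 1) := by simp [transposeM3]
    cases v <;> simp [lowerIdx, upperGens, transposeM3_upperMinor, hX] at key h8 h9 hlow
    · exact key h8
    · exact h9
    · exact key hlow
    · exact h9
    · simp_all
    · simp_all
  have h22 : mk (X (2, 2)) ∈ T := by
    refine hdiv 1 (by simp [clusterIdx]) _ ?_
    have hdet : mk (Det3 k - 1) = 0 :=
      Ideal.Quotient.eq_zero_iff_mem.2 (det_sub_one_mem_cellIdeal _ _)
    have : mk (clusterVar k 1) * mk (X (2, 2)) = 1 +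
        mk (X (1, 2)) * (mk (X (0, 0)) * mk (X (2, 1)) - mk (X (0, 1)) * mk (X (2, 0))) -
        mk (X (0, 2)) * (mk (X (1, 0)) * mk (X (2, 1)) - mk (X (1, 1)) * mk (X (2, 0))) := by
      rw [det3_eq] at hdet
      simp only [map_sub, map_add, map_mul, map_one] at hdet
      simp only [clusterVar, leadingMinor, Matrix.cons_val, map_mul, map_sub]
      linear_combination hdet
    rw [this]
    exact sub_mem (add_mem (one_mem _) (mul_mem h12 (sub_mem (mul_mem h00 h21)
      (mul_mem h01 h20)))) (mul_mem h02 (sub_mem (mul_mem h10 h21) (mul_mem h11 h20)))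
  induction f using MvPolynomial.induction_on with
  | C c => exact T.algebraMap_mem c
  | add p q hp hq => exact map_add mk p q ▸ add_mem hp hq
  | mul_X p i hp =>
    rw [map_mul]
    refine mul_mem hp ?_
    obtain ⟨i, j⟩ := i
    fin_cases i <;> fin_cases j <;> assumption

/-- For `f ∈ Q`, a product `m` of cluster elements makes `m * f` a polynomial in them modulo the
cell ideal. That polynomial lies in `Q`, so it is zero; as `m ∉ Q` and the cell ideal is prime, `f`
belongs to the cell ideal. -/
theorem IsPoissonTorusPrime.exists_eq_cellIdeal [CharZero k] {Q : Ideal (CoordM3 k)}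
    (hQ : IsPoissonTorusPrime Q) : ∃ u v, Q = cellIdeal k u v := by
  obtain ⟨u, v, hle, hne⟩ := hQ.exists_cellIdeal_le
  refine ⟨u, v, le_antisymm (fun f hf => ?_) hle⟩
  have hprime := (Ideal.Quotient.isDomain_iff_prime _).1 (ufd_cellIdeal (k := k) u v).1
  have hM : Submonoid.closure (Set.range fun i : clusterIdx u v =>
      Ideal.Quotient.mkₐ k (cellIdeal k u v) (clusterVar k i)) ≤
      ((Ideal.Quotient.mkₐ k (cellIdeal k u v)).comp
        (aeval fun i : clusterIdx u v => clusterVar k i)).range.toSubmonoid := by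
    rw [Submonoid.closure_le]
    rintro _ ⟨i, rfl⟩
    exact ⟨X i, by simp⟩
  have := hQ.isPrime
  have := hprime
  let ψ := Ideal.Quotient.factor hle
  have hψ : Submonoid.closure (Set.range fun i : clusterIdx u v =>
      Ideal.Quotient.mkₐ k (cellIdeal k u v) (clusterVar k i)) ≤
      (nonZeroDivisors (CoordM3 k ⧸ Q)).comap ψ := by
    rw [Submonoid.closure_le]
    rintro _ ⟨i, rfl⟩
    exact mem_nonZeroDivisors_of_ne_zero fun h => hne i i.2 (Ideal.Quotient.eq_zero_iff_mem.1 h)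
  obtain ⟨m, hm, p, hp⟩ := mem_saturation_clusterVar hM f
  have hp' : Ideal.Quotient.mk (cellIdeal k u v) (aeval (fun i => clusterVar k i.1) p) =
      m * Ideal.Quotient.mk (cellIdeal k u v) f := hp
  have hm0 := nonZeroDivisors.ne_zero (hψ hm)
  have hpQ : aeval (fun i => clusterVar k i.1) p ∈ Q := by
    rw [← Ideal.Quotient.eq_zero_iff_mem]
    have := congrArg ψ hp'
    rw [map_mul] at this
    simpa [ψ, Ideal.Quotient.eq_zero_iff_mem.2 hf] using this
  rw [hQ.eq_zero_of_aeval_clusterVar_mem hle hne p hpQ, map_zero, map_zero, eq_comm,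
    mul_eq_zero] at hp'
  exact Ideal.Quotient.eq_zero_iff_mem.1 (hp'.resolve_left fun h => hm0 (by rw [h, map_zero]))

end Coordinates

theorem proposition5p3p20 {k : Type*} [Field k] [IsAlgClosed k] [CharZero k]
    (I : Ideal (CoordSL3 k)) (hI : IsPoissonHPrime I) :
    IsDomain (CoordSL3 k ⧸ I) ∧ UniqueFactorizationMonoid (CoordSL3 k ⧸ I) := by
  obtain ⟨u, v, h⟩ := hI.isPoissonTorusPrime_comap.exists_eq_cellIdeal
  let φ := (Ideal.Quotient.mk I).comp (Ideal.Quotient.mk (detIdeal k))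
  have hφ : Function.Surjective φ :=
    Ideal.Quotient.mk_surjective.comp Ideal.Quotient.mk_surjective
  have hker : RingHom.ker φ = cellIdeal k u v := by
    rw [← h, ← RingHom.comap_ker, Ideal.mk_ker]
  let e : CoordM3 k ⧸ cellIdeal k u v ≃+* CoordSL3 k ⧸ I :=
    (Ideal.quotEquivOfEq hker.symm).trans (RingHom.quotientKerEquivOfSurjective hφ)
  exact isDomain_ufd_of_ringEquiv (A := CoordSL3 k ⧸ I) (B := CoordM3 k ⧸ cellIdeal k u v) e.symm
    (ufd_cellIdeal u v)
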